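/- Let $g\ge 0$ be an integer and let $M_g\simeq\mathbb{C}^{3g+1}$ be the affine space of matrices $$A(x)=\begin{pmatrix} v(x) & u(x)\\ w(x) & -v(x)\end{pmatrix},\quad u=x^g+\sum_{k<g}u_kx^k,\quad v=\sum_{k<g}v_kx^k,\quad w=x^{g+1}+\sum_{k\le g}w_kx^k,$$ with coordinates $u_k,v_k,w_k\in\mathbb{C}$. Equip $M_g$ with the Poisson bracket determined by $$\{u_i,u_j\}=\{v_i,v_j\}=0,\quad \{u_i,v_j\}=u_{i+j+1},\quad \{u_i,w_j\}=-2v_{i+j+1},$$ $$\{v_i,w_j\}=w_{i+j+1}-\delta_{0,j}u_i,\quad \{w_i,w_j\}=2(\delta_{0,j}v_i-\delta_{i,0}v_j),$$ where $u_g=w_{g+1}=1$ and all other coefficients outside the above ranges are $0$. Let $\mathbf{H}(A)=-\det A(x)=v(x)^2+u(x)w(x)=x^{2g+1}+\sum_{k=0}^{2g}h_k(A)x^k$, and let $D_k=\{\cdot,h_k\}$, for $0\le k\le g-1$, be the Hamiltonian vector fields of $h_0,\dots,h_{g-1}$. For a monic polynomial $h\in\mathbb{C}[x]$ of degree $2g+1$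 and an integer $i\ge 0$ put $$M_{g,i}(h)=\{A\in M_g \mid \mathbf{H}(A)=h,\ \dim\langle D_0|_A,\dots,D_{g-1}|_A\rangle=i\}.$$ Then every stratum of the fibre $M_g(h)=\mathbf{H}^{-1}(h)$, that is, every non-empty $M_{g,i}(h)$, is a (not necessarily irreducible) quasi-affine variety which is smooth and of dimension $i$. In detail: it is Zariski locally closed in $M_g$; with its reduced structure, its local ring at each of its points is a regular local ring of Krull dimension $i$; and its Krull dimension as a topological space for the Zariski topology is $i$. -/

import Mathlib

open Polynomial Topology

noncomputable section

/-! ### Classical quasi-affine varieties over the complex numbers -/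

namespace ClassicalVariety

variable {σ : Type*}

/-- The Zariski topology on the affine space `ℂ^σ`, induced from the prime spectrum of the
polynomial ring; `isClosed_zariski_iff` says that its closed sets are the zero loci. -/
@[reducible] def zariskiTopology (σ : Type*) : TopologicalSpace (σ → ℂ) :=
  TopologicalSpace.induced
    (MvPolynomial.pointToPoint : (σ → ℂ) → PrimeSpectrum (MvPolynomial σ ℂ)) inferInstance

theorem isClosed_zariski_iff (Z : Set (σ → ℂ)) :
    IsClosed[zariskiTopology σ] Z ↔
      ∃ I : Ideal (MvPolynomial σ ℂ), Z = MvPolynomial.zeroLocus ℂ I := by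
  have key : ∀ s : Set (MvPolynomial σ ℂ),
      (MvPolynomial.pointToPoint : (σ → ℂ) → PrimeSpectrum (MvPolynomial σ ℂ)) ⁻¹'
        PrimeSpectrum.zeroLocus s = {x | ∀ p ∈ s, MvPolynomial.aeval x p = 0} := by
    intro s
    ext x
    simp only [Set.mem_preimage, PrimeSpectrum.mem_zeroLocus, Set.mem_ofPred_eq]
    exact ⟨fun h p hp => h hp x rfl,
      fun h p hp => (MvPolynomial.mem_vanishingIdeal_singleton_iff x p).2 (h p hp)⟩
  unfold zariskiTopology
  rw [isClosed_induced_iff]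
  constructor
  · rintro ⟨t, ht, rfl⟩
    obtain ⟨s, rfl⟩ := (PrimeSpectrum.isClosed_iff_zeroLocus t).1 ht
    exact ⟨Ideal.span s, by rw [key, MvPolynomial.zeroLocus_span]⟩
  · rintro ⟨I, rfl⟩
    exact ⟨PrimeSpectrum.zeroLocus (I : Set (MvPolynomial σ ℂ)),
      PrimeSpectrum.isClosed_zeroLocus _, by rw [key]; rfl⟩

/-- A quasi-affine variety (not assumed irreducible): a Zariski locally closed subset of an
affine space. -/
def IsQuasiAffine (S : Set (σ → ℂ)) : Prop :=
  @IsLocallyClosed _ (zariskiTopology σ) S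

/-- The dimension of `S`: the Krull dimension of `S` with the topology induced by the Zariski
topology. The empty set has dimension `⊥`. -/
def dimension (S : Set (σ → ℂ)) : WithBot ℕ∞ :=
  @topologicalKrullDim S
    (TopologicalSpace.induced (Subtype.val : S → (σ → ℂ)) (zariskiTopology σ))

/-- The local ring at `p` of the affine space `ℂ^σ`. -/
abbrev AffineLocalRing (p : σ → ℂ) : Type _ :=
  Localization.AtPrime (MvPolynomial.vanishingIdeal ℂ {p} : Ideal (MvPolynomial σ ℂ))

/-- The local ring at `p` of the quasi-affine variety `S` with its reduced structure: the local
ring of the affine space at `p` modulo the polynomials that vanish on `S`. -/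
abbrev LocalRing (S : Set (σ → ℂ)) (p : σ → ℂ) : Type _ :=
  AffineLocalRing p ⧸
    (MvPolynomial.vanishingIdeal ℂ S).map (algebraMap (MvPolynomial σ ℂ) (AffineLocalRing p))

/-- A quasi-affine variety is smooth if its local ring at each of its points is regular. -/
def IsSmooth (S : Set (σ → ℂ)) : Prop :=
  ∀ p ∈ S, IsRegularLocalRing (LocalRing S p)

/-- `S` has dimension `d` at each of its points. -/
def IsEquidimensional (S : Set (σ → ℂ)) (d : ℕ) : Prop :=
  ∀ p ∈ S, ringKrullDim (LocalRing S p) = d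

end ClassicalVariety

/-! ### The Mumford system of order `g` -/

namespace Mumford

variable (g : ℕ)

/-- Index set of the `3g+1` coordinates of the phase space. -/
abbrev Coord : Type := Fin g ⊕ Fin g ⊕ Fin (g + 1)

/-- The phase space `M_g`, identified with the affine space `ℂ^{3g+1}`. -/
abbrev PhaseSpace : Type := Coord g → ℂ

section LaxMatrix

variable {R : Type*} [CommRing R]

/-- `u(x) = x^g + u_{g-1} x^{g-1} + ⋯ + u_0`. -/
def uPoly (c : Coord g → R) : R[X] := X ^ g + ∑ i : Fin g, C (c (.inl i)) * X ^ (i : ℕ)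

/-- `v(x) = v_{g-1} x^{g-1} + ⋯ + v_0`. -/
def vPoly (c : Coord g → R) : R[X] := ∑ i : Fin g, C (c (.inr (.inl i))) * X ^ (i : ℕ)

/-- `w(x) = x^{g+1} + w_g x^g + ⋯ + w_0`. -/
def wPoly (c : Coord g → R) : R[X] :=
  X ^ (g + 1) + ∑ i : Fin (g + 1), C (c (.inr (.inr i))) * X ^ (i : ℕ)

/-- The matrix `A(x)` with coordinates `c`. -/
def laxMatrix (c : Coord g → R) : Matrix (Fin 2) (Fin 2) R[X] :=
  !![vPoly g c, uPoly g c; wPoly g c, -vPoly g c]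

/-- The moment map `H(A) = -det A(x) = v(x)² + u(x) w(x)`. -/
def momentMap (c : Coord g → R) : R[X] := -(laxMatrix g c).det

end LaxMatrix

/-- The fibre `M_g(h)` of the moment map. -/
def fiber (h : ℂ[X]) : Set (PhaseSpace g) := {A | momentMap g A = h}

/-- The algebra of polynomial functions on `M_g`. -/
abbrev Functions : Type := MvPolynomial (Coord g) ℂ

/-- The coordinate function `u_k` for `k < g`, extended by `u_g = 1` and `u_k = 0` for `k > g`. -/
def uCoef (k : ℕ) : Functions g := (uPoly g MvPolynomial.X).coeff k

/-- The coordinate function `v_k` for `k < g`, extended by `v_k = 0` for `k ≥ g`. -/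
def vCoef (k : ℕ) : Functions g := (vPoly g MvPolynomial.X).coeff k

/-- The coordinate function `w_k` for `k ≤ g`, extended by `w_{g+1} = 1` and `w_k = 0` for
`k > g + 1`. -/
def wCoef (k : ℕ) : Functions g := (wPoly g MvPolynomial.X).coeff k

/-- The brackets of the coordinate functions:
`{u_i,u_j} = {v_i,v_j} = 0`, `{u_i,v_j} = u_{i+j+1}`, `{u_i,w_j} = -2 v_{i+j+1}`,
`{v_i,w_j} = w_{i+j+1} - δ_{0,j} u_i`, `{w_i,w_j} = 2 (δ_{0,j} v_i - δ_{i,0} v_j)`. -/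
def coordBracket : Coord g → Coord g → Functions g
  | .inl _, .inl _ => 0
  | .inl i, .inr (.inl j) => uCoef g (i + j + 1)
  | .inr (.inl i), .inl j => -uCoef g (j + i + 1)
  | .inl i, .inr (.inr j) => -2 * vCoef g (i + j + 1)
  | .inr (.inr i), .inl j => 2 * vCoef g (j + i + 1)
  | .inr (.inl _), .inr (.inl _) => 0
  | .inr (.inl i), .inr (.inr j) => wCoef g (i + j + 1) - if j = 0 then uCoef g i else 0
  | .inr (.inr i), .inr (.inl j) => -(wCoef g (j + i + 1) - if i = 0 then uCoef g j else 0)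
  | .inr (.inr i), .inr (.inr j) =>
      2 * ((if j = 0 then vCoef g i else 0) - if i = 0 then vCoef g j else 0)

/-- The Poisson bracket on `M_g`: the biderivation with the given brackets of coordinates. -/
def poissonBracket (F G : Functions g) : Functions g :=
  ∑ a, ∑ b, coordBracket g a b * MvPolynomial.pderiv a F * MvPolynomial.pderiv b G

/-- The function `h_i` on `M_g`: the coefficient of `x^i` in the moment map. -/
def hamiltonian (i : ℕ) : Functions g := (momentMap g MvPolynomial.X).coeff i

/-- The value at `A` of the Hamiltonian vector field `D_i = {·, h_i}`, in coordinates. -/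
def vectorField (i : ℕ) (A : PhaseSpace g) : Coord g → ℂ := fun a =>
  MvPolynomial.eval A (poissonBracket g (MvPolynomial.X a) (hamiltonian g i))

/-- The stratum `M_{g,i}`: the points where `D_0, …, D_{g-1}` span a space of dimension `i`. -/
def stratum (i : ℕ) : Set (PhaseSpace g) :=
  {A | Module.finrank ℂ (Submodule.span ℂ (Set.range fun k : Fin g => vectorField g k A)) = i}

/-- The stratum `M_{g,i}(h) = M_g(h) ∩ M_{g,i}` of the fibre `M_g(h)`. -/
def fiberStratum (i : ℕ) (h : ℂ[X]) : Set (PhaseSpace g) := fiber g h ∩ stratum g i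

end Mumford

end

open Polynomial Topology

noncomputable section

/-! ### Regular local rings -/

section RegularLocalRing

open IsLocalRing

variable {A : Type*} [CommRing A]

/-! Let Q be the monic greatest common divisor of u, v, w at A, and (u, v, w) = Q (u', v', w').
Everything rests on the rank formula `GcdFactorization.fieldRank_eq`: D_0, …, D_{g-1} span a space
of dimension g - deg Q = deg u'. For coefficients c let U, V, W be obtained from u, v, w by applying
y^k ↦ c_k to (p(x) - p(y))/(x - y), with W corrected by a constant. Since the Bezoutian is
symmetric, the components of ∑ c_k D_k are, up to scalar factors, the 2×2 minors of (u, v, w) and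
(U, V, W), so the sum vanishes exactly when (U, V, W) is a polynomial multiple of (u', v', w').
Counting such c gives a space of dimension deg Q.

On the fibre Q² divides h, so only finitely many Q occur, and near A the stratum of rank i = deg u'
is given by the conditions that Q divide u, v, w and that the quotient of H - h by Q² vanish
(`GcdFactorization.exists_isOpen`). These are 3 deg Q + 2i + 1 equations in 3g + 1 = 3 (deg Q + i) +
1 unknowns. Their differentials are independent: the remainders modulo Q can be prescribed freely,
and 2v'β + u'γ + w'α takes every value of degree at most 2i because u', v', w' generate the unit
ideal (`GcdFactorization.exists_jacobian_eq`). The Jacobian criterion `isRegularLocalRing_localRing`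
then gives regular local rings of dimension i; it uses that a regular local ring is a domain, so
that the equations generate the full ideal of the stratum at A. Finally
`dimension_eq_of_isEquidimensional` compares chains of irreducible closed sets with chains of primes
in the local rings. -/

theorem IsLocalRing.exists_ringKrullDim_eq (A : Type*) [CommRing A] [IsLocalRing A]
    [IsNoetherianRing A] : ∃ m : ℕ, ringKrullDim A = m := by
  have h1 := ringKrullDim_ne_bot (R := A)
  have h2 := ringKrullDim_ne_top (R := A)
  generalize ringKrullDim A = r at h1 h2
  induction r with
  | bot => exact absurd rfl h1
  | coe r =>
    induction r with
    | top => exact absurd rfl h2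
    | coe r => exact ⟨r, rfl⟩

/-- If elements of the maximal ideal of a regular local ring are linearly independent in the
cotangent space, the quotient by them is regular, and its dimension drops by their number. -/
theorem IsRegularLocalRing.quotient_span_range [IsRegularLocalRing A] {ι : Type*} [Fintype ι]
    (f : ι → A) (hf : ∀ j, f j ∈ maximalIdeal A)
    (hind : ∀ a : ι → A, ∑ j, a j * f j ∈ maximalIdeal A ^ 2 → ∀ j, a j ∈ maximalIdeal A) :
    IsRegularLocalRing (A ⧸ Ideal.span (Set.range f)) ∧
      ringKrullDim (A ⧸ Ideal.span (Set.range f)) + Fintype.card ι = ringKrullDim A := by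
  classical
  set I := Ideal.span (Set.range f) with hI
  have hIm : I ≤ maximalIdeal A := Ideal.span_le.2 (by rintro _ ⟨j, rfl⟩; exact hf j)
  have hItop : I ≠ ⊤ := fun h => (maximalIdeal.isMaximal A).ne_top (top_le_iff.1 (h ▸ hIm))
  have : Nontrivial (A ⧸ I) := Ideal.Quotient.nontrivial_iff.2 hItop
  have hloc : IsLocalRing (A ⧸ I) :=
    IsLocalRing.of_surjective' (Ideal.Quotient.mk I) Ideal.Quotient.mk_surjective
  let v : ι → CotangentSpace A := fun j => (maximalIdeal A).toCotangent ⟨f j, hf j⟩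
  have hv : LinearIndependent (ResidueField A) v := by
    rw [Fintype.linearIndependent_iff]
    intro k hk
    choose a ha using fun j => residue_surjective (k j)
    have h1 : (maximalIdeal A).toCotangent (∑ j, a j • ⟨f j, hf j⟩) = 0 := by
      rw [map_sum, ← hk]
      refine Finset.sum_congr rfl fun j _ => ?_
      rw [map_smul, ← ha j]
      rfl
    rw [Ideal.toCotangent_eq_zero] at h1
    have h2 := hind a (by simpa using h1)
    intro j
    rw [← ha j, residue_eq_zero_iff]
    exact h2 j
  -- Complete the classes of the f j to a basis of the cotangent space. By Nakayama the lifts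
  -- generate the maximal ideal, so the added ones alone generate that of the quotient. Its
  -- embedding dimension thus drops by at least the number of f j, while the Krull dimension drops
  -- by at most that number.
  let b := Module.Basis.sumExtend hv
  have hfin : Finite (ι ⊕ Module.Basis.sumExtendIndex hv) := Module.Finite.finite_basis b
  have : Finite (Module.Basis.sumExtendIndex hv) := Finite.of_injective (β := ι ⊕ Module.Basis.sumExtendIndex hv) _ Sum.inr_injective
  have : Fintype (Module.Basis.sumExtendIndex hv) := Fintype.ofFinite _
  have hcard : Module.finrank (ResidueField A) (CotangentSpace A) =
      Fintype.card ι + Fintype.card (Module.Basis.sumExtendIndex hv) := by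
    rw [Module.finrank_eq_card_basis b, Fintype.card_sum]
  choose t ht using fun k : Module.Basis.sumExtendIndex hv =>
    (maximalIdeal A).toCotangent_surjective (b (Sum.inr k))
  let F : ι ⊕ Module.Basis.sumExtendIndex hv → maximalIdeal A :=
    Sum.elim (fun j => ⟨f j, hf j⟩) t
  have hF : ∀ s, (maximalIdeal A).toCotangent (F s) = b s := by
    rintro (j | k)
    · simp only [F, Sum.elim_inl, b, Module.Basis.sumExtend, Module.Basis.reindex_apply]
      simp [v, Trans.trans]
      rfl
    · simp [F, ht]
  have hspan : Submodule.span A (Set.range F) = ⊤ := by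
    rw [← CotangentSpace.span_image_eq_top_iff, ← Set.range_comp]
    have : ((maximalIdeal A).toCotangent ∘ F) = b := funext hF
    rw [this, b.span_eq]
  have hmax : maximalIdeal (A ⧸ I) ≤
      Ideal.span (Set.range fun k => Ideal.Quotient.mk I (t k : A)) := by
    intro y hy
    obtain ⟨x, rfl⟩ := Ideal.Quotient.mk_surjective y
    have hx : x ∈ maximalIdeal A := by
      rw [mem_maximalIdeal, mem_nonunits_iff] at hy ⊢
      exact fun h => hy (h.map _)
    have hx' : (⟨x, hx⟩ : maximalIdeal A) ∈ Submodule.span A (Set.range F) := hspan ▸ trivial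
    obtain ⟨c, hc⟩ := (Submodule.mem_span_range_iff_exists_fun A).1 hx'
    have hc' : x = ∑ j, c (Sum.inl j) * f j + ∑ k, c (Sum.inr k) * (t k : A) := by
      have := congrArg Subtype.val hc
      simpa [F, Fintype.sum_sum_type] using this.symm
    have h0 : Ideal.Quotient.mk I (∑ j, c (Sum.inl j) * f j) = 0 :=
      Ideal.Quotient.eq_zero_iff_mem.2 <| Ideal.sum_mem _ fun j _ =>
        Ideal.mul_mem_left _ _ (Ideal.subset_span ⟨j, rfl⟩)
    rw [hc', map_add, h0, zero_add, map_sum]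
    refine Ideal.sum_mem _ fun k _ => ?_
    rw [map_mul]
    exact Ideal.mul_mem_left _ _ (Ideal.subset_span ⟨k, rfl⟩)
  have hmax' : Ideal.span (Set.range fun k => Ideal.Quotient.mk I (t k : A)) =
      maximalIdeal (A ⧸ I) := by
    refine le_antisymm (Ideal.span_le.2 ?_) hmax
    rintro _ ⟨k, rfl⟩
    rw [SetLike.mem_coe, mem_maximalIdeal, mem_nonunits_iff]
    intro hu
    obtain ⟨y, hy⟩ := hu.exists_right_inv
    obtain ⟨z, rfl⟩ := Ideal.Quotient.mk_surjective y
    rw [← map_mul, ← map_one (Ideal.Quotient.mk I), Ideal.Quotient.eq] at hy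
    have h1 : (1 : A) ∈ maximalIdeal A := by
      have := (maximalIdeal A).sub_mem (Ideal.mul_mem_right z _ (t k).2) (hIm hy)
      simp at this
    exact absurd h1 ((Ideal.ne_top_iff_one _).1 (maximalIdeal.isMaximal A).ne_top)
  have hrank : (maximalIdeal (A ⧸ I)).spanFinrank ≤
      Fintype.card (Module.Basis.sumExtendIndex hv) := by
    rw [← hmax', ← Set.image_univ]
    refine (Submodule.spanFinrank_span_le_ncard_of_finite (Set.toFinite _)).trans ?_
    refine (Set.ncard_image_le (Set.toFinite _)).trans ?_
    rw [Set.ncard_univ, Nat.card_eq_fintype_card]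
  have hdimA := (IsRegularLocalRing.iff_finrank_cotangentSpace A).1 inferInstance
  have hdim : ringKrullDim A ≤ ringKrullDim (A ⧸ I) + Fintype.card ι := by
    have h1 := ringKrullDim_le_ringKrullDim_quotient_add_spanFinrank I
      (hIm.trans (ringJacobson_eq_maximalIdeal A).ge)
    refine h1.trans ?_
    gcongr
    rw [hI, ← Set.image_univ]
    refine (Submodule.spanFinrank_span_le_ncard_of_finite (Set.toFinite _)).trans ?_
    refine (Set.ncard_image_le (Set.toFinite _)).trans ?_
    rw [Set.ncard_univ, Nat.card_eq_fintype_card]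
  have hdim' := ringKrullDim_le_spanFinrank_maximalIdeal (A ⧸ I)
  obtain ⟨m, hm⟩ := IsLocalRing.exists_ringKrullDim_eq (A ⧸ I)
  rw [← hdimA, hm, hcard] at hdim
  rw [hm] at hdim'
  norm_cast at hdim hdim'
  constructor
  · refine IsRegularLocalRing.of_spanFinrank_maximalIdeal_le _ ?_
    rw [hm]
    norm_cast
    omega
  · rw [hm, ← hdimA, hcard]
    norm_cast
    omega

/-- Induction on the embedding dimension. Prime avoidance gives x in the maximal ideal, outside its
square and outside every minimal prime. The quotient by x is regular of smaller dimension, hence a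
domain, so (x) is prime. A minimal prime P inside (x) satisfies P = xP because x ∉ P, and Nakayama
gives P = 0. -/
theorem IsRegularLocalRing.isDomain_of_spanFinrank (n : ℕ) :
    ∀ (A : Type*) [CommRing A] [IsRegularLocalRing A],
      (maximalIdeal A).spanFinrank = n → IsDomain A := by
  classical
  induction n with
  | zero =>
    intro A _ _ h
    have h0 : maximalIdeal A = ⊥ :=
      (Submodule.spanFinrank_eq_zero_iff_eq_bot (maximalIdeal A).fg_of_isNoetherianRing).1 h
    exact (isField_iff_maximalIdeal_eq.2 h0).isDomain
  | succ n ih =>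
    intro A _ _ h
    have hreg := IsRegularLocalRing.spanFinrank_maximalIdeal (R := A)
    obtain ⟨x, hxm, hx2, hxmin⟩ : ∃ x ∈ maximalIdeal A, x ∉ maximalIdeal A ^ 2 ∧
        ∀ P ∈ minimalPrimes A, x ∉ P := by
      by_contra! hcon
      have hfin := minimalPrimes.finite_of_isNoetherianRing A
      let s : Finset (Ideal A) := insert (maximalIdeal A ^ 2) hfin.toFinset
      have hsub : ((maximalIdeal A : Ideal A) : Set A) ⊆ ⋃ i ∈ (↑s : Set (Ideal A)), (i : Set A) := by
        intro x hx
        by_cases hx2 : x ∈ maximalIdeal A ^ 2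
        · exact Set.mem_biUnion (by simp [s]) hx2
        · obtain ⟨P, hP, hxP⟩ := hcon x hx hx2
          exact Set.mem_biUnion (by simp [s, hP]) hxP
      -- Prime avoidance tolerates two ideals that need not be prime; the only exception here is the
      -- square of the maximal ideal, named twice.
      obtain ⟨P, hPs, hle⟩ := (Ideal.subset_union_prime (f := id) (maximalIdeal A ^ 2)
        (maximalIdeal A ^ 2) (by
          intro P hP hne _
          simp only [s, Finset.mem_insert, hne, false_or, Set.Finite.mem_toFinset] at hP
          exact hP.1.1)).1 hsub
      simp only [s, Finset.mem_insert, Set.Finite.mem_toFinset] at hPs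
      rcases hPs with rfl | hP
      · have hbot : maximalIdeal A = ⊥ := by
          refine Submodule.eq_bot_of_le_smul_of_le_jacobson_bot (maximalIdeal A) _
            (IsNoetherian.noetherian _) ?_ (jacobson_eq_maximalIdeal ⊥ bot_ne_top).ge
          rw [smul_eq_mul, ← pow_two]
          exact hle
        rw [hbot] at h
        simp at h
      · have := hP.1.1
        have heq : maximalIdeal A = P := le_antisymm hle (le_maximalIdeal this.ne_top)
        have : (maximalIdeal A).height = 0 := by
          rw [heq]
          exact Ideal.height_eq_zero_iff.2 hP
        have h2 := maximalIdeal_height_eq_ringKrullDim (R := A)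
        rw [← hreg, this, h] at h2
        norm_cast at h2
    obtain ⟨hreg', hdim'⟩ := IsRegularLocalRing.quotient_span_range (fun _ : Unit => x)
      (fun _ => hxm) (by
        intro a ha _
        by_contra hu
        rw [mem_maximalIdeal, mem_nonunits_iff, not_not] at hu
        simp only [Finset.univ_unique, Finset.sum_singleton] at ha
        exact hx2 ((Ideal.unit_mul_mem_iff_mem _ hu).1 ha))
    rw [Set.range_const] at hreg' hdim'
    have hdom : IsDomain (A ⧸ Ideal.span {x}) := by
      apply ih
      have h3 := IsRegularLocalRing.spanFinrank_maximalIdeal (R := A ⧸ Ideal.span {x})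
      rw [← hreg, ← h3, h] at hdim'
      simp only [Fintype.card_unit] at hdim'
      norm_cast at hdim'
      omega
    have hprime : (Ideal.span {x}).IsPrime := (Ideal.Quotient.isDomain_iff_prime _).1 hdom
    obtain ⟨P, hP, hPx⟩ := Ideal.exists_minimalPrimes_le (I := ⊥) (J := Ideal.span {x}) bot_le
    have hPprime : P.IsPrime := hP.1.1
    have hPbot : P = ⊥ := by
      refine Submodule.eq_bot_of_le_smul_of_le_jacobson_bot (maximalIdeal A) _
        (IsNoetherian.noetherian _) ?_ (jacobson_eq_maximalIdeal ⊥ bot_ne_top).ge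
      intro y hy
      obtain ⟨a, rfl⟩ := Ideal.mem_span_singleton'.1 (hPx hy)
      have ha : a ∈ P := (hPprime.mem_or_mem hy).resolve_right (hxmin P hP)
      rw [mul_comm]
      exact Submodule.smul_mem_smul hxm ha
    rw [hPbot] at hPprime
    exact IsDomain.of_bot_isPrime A

/-- A regular local ring is a domain. -/
theorem IsRegularLocalRing.isDomain (A : Type*) [CommRing A] [IsRegularLocalRing A] : IsDomain A :=
  IsRegularLocalRing.isDomain_of_spanFinrank _ A rfl

end RegularLocalRing

/-! ### Local rings and dimension of quasi-affine varieties -/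

namespace Topology.IsInducing

theorem isIrreducible_image_iff {X Y : Type*} [TopologicalSpace X] [TopologicalSpace Y]
    {f : X → Y} (hf : IsInducing f) {s : Set X} : IsIrreducible (f '' s) ↔ IsIrreducible s := by
  refine ⟨fun h => ⟨Set.image_nonempty.1 h.1, ?_⟩, fun h => h.image f hf.continuous.continuousOn⟩
  rintro u v hu hv ⟨x, hxs, hxu⟩ ⟨y, hys, hyv⟩
  obtain ⟨u', hu', rfl⟩ := hf.isOpen_iff.1 hu
  obtain ⟨v', hv', rfl⟩ := hf.isOpen_iff.1 hv
  obtain ⟨_, ⟨z, hz, rfl⟩, hzu, hzv⟩ := h.2 u' v' hu' hv' ⟨f x, ⟨x, hxs, rfl⟩, hxu⟩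
    ⟨f y, ⟨y, hys, rfl⟩, hyv⟩
  exact ⟨z, hz, hzu, hzv⟩

end Topology.IsInducing

namespace ClassicalVariety

open IsLocalRing MvPolynomial

variable {σ : Type*}

theorem exists_ne_zero_of_isOpen {U : Set (σ → ℂ)} (hU : IsOpen[zariskiTopology σ] U)
    {p : σ → ℂ} (hp : p ∈ U) :
    ∃ s : MvPolynomial σ ℂ, eval p s ≠ 0 ∧ ∀ x, x ∉ U → eval x s = 0 := by
  have hc : IsClosed[zariskiTopology σ] Uᶜ := by
    let _ := zariskiTopology σ
    exact hU.isClosed_compl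
  obtain ⟨I, hI⟩ := (isClosed_zariski_iff _).1 hc
  have hpI : p ∉ zeroLocus ℂ I := by rw [← hI]; simpa using hp
  simp only [mem_zeroLocus_iff, not_forall] at hpI
  obtain ⟨s, hs, hps⟩ := hpI
  refine ⟨s, by simpa [aeval_eq_eval] using hps, fun x hx => ?_⟩
  have : x ∈ zeroLocus ℂ I := by rw [← hI]; exact hx
  simpa [aeval_eq_eval] using this s hs

theorem isClosed_setOf_eval_eq_zero {ι : Type*} (f : ι → MvPolynomial σ ℂ) :
    IsClosed[zariskiTopology σ] {x | ∀ j, eval x (f j) = 0} := by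
  rw [isClosed_zariski_iff]
  refine ⟨Ideal.span (Set.range f), ?_⟩
  rw [zeroLocus_span]
  ext x
  simp [aeval_eq_eval]

theorem isOpen_setOf_eval_ne_zero (f : MvPolynomial σ ℂ) :
    IsOpen[zariskiTopology σ] {x | eval x f ≠ 0} := by
  let _ := zariskiTopology σ
  rw [← isClosed_compl_iff]
  convert isClosed_setOf_eval_eq_zero (fun _ : Unit => f) using 1
  ext x
  simp

/-- The translation of coordinates by `t`. -/
def translation (t : σ → ℂ) : MvPolynomial σ ℂ ≃ₐ[ℂ] MvPolynomial σ ℂ :=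
  AlgEquiv.ofAlgHom (MvPolynomial.aeval fun a => MvPolynomial.X a + MvPolynomial.C (t a))
    (MvPolynomial.aeval fun a => MvPolynomial.X a - MvPolynomial.C (t a))
    (by ext a; simp [MvPolynomial.algebraMap_eq]) (by ext a; simp [MvPolynomial.algebraMap_eq])

theorem height_vanishingIdeal_singleton_eq (p q : σ → ℂ) :
    (vanishingIdeal ℂ {p} : Ideal (MvPolynomial σ ℂ)).height =
      (vanishingIdeal ℂ {q} : Ideal (MvPolynomial σ ℂ)).height := by
  rw [← RingEquiv.height_comap (translation fun a => q a - p a).toRingEquiv]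
  congr 1
  ext f
  have h : ((MvPolynomial.aeval p : MvPolynomial σ ℂ →ₐ[ℂ] ℂ).comp
      (translation fun a => q a - p a).toAlgHom) = MvPolynomial.aeval q := by
    ext a
    simp [translation]
  rw [Ideal.mem_comap, mem_vanishingIdeal_singleton_iff, mem_vanishingIdeal_singleton_iff, ← h]
  rfl

/-- Some maximal ideal has height equal to the dimension of the polynomial ring. By the
Nullstellensatz it belongs to a point, and translations carry this point to any other. -/
theorem ringKrullDim_affineLocalRing [Finite σ] (p : σ → ℂ) :
    ringKrullDim (AffineLocalRing p) = Nat.card σ := by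
  have hdim : ringKrullDim (MvPolynomial σ ℂ) = Nat.card σ := by simp
  have : FiniteRingKrullDim (MvPolynomial σ ℂ) := by
    rw [finiteRingKrullDim_iff_ne_bot_and_top, hdim]
    exact ⟨WithBot.coe_ne_bot, fun h => ENat.natCast_ne_top _ (WithBot.coe_injective h)⟩
  obtain ⟨m, hm, hht⟩ := Ideal.exists_isMaximal_height (R := MvPolynomial σ ℂ)
  obtain ⟨q, rfl⟩ := isMaximal_iff_eq_vanishingIdeal_singleton.1 hm
  rw [IsLocalization.AtPrime.ringKrullDim_eq_height (vanishingIdeal ℂ {p}),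
    height_vanishingIdeal_singleton_eq p q, hht, hdim]

theorem eval_pderiv_eq_zero_of_mem_sq (p : σ → ℂ) (a : σ) {F : MvPolynomial σ ℂ}
    (hF : F ∈ (vanishingIdeal ℂ {p} : Ideal (MvPolynomial σ ℂ)) ^ 2) :
    eval p (pderiv a F) = 0 := by
  rw [pow_two] at hF
  refine Submodule.mul_induction_on hF (fun x hx y hy => ?_) fun x y hx hy => ?_
  · rw [mem_vanishingIdeal_singleton_iff, aeval_eq_eval] at hx hy
    simp [Derivation.leibniz, hx, hy]
  · simp [hx, hy]

/-- **Jacobian criterion.** If near `p` the set `S` is cut out by polynomials whose Jacobian matrix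
at `p` has maximal rank, then the local ring of `S` at `p` is regular, and its dimension is the
expected one. -/
theorem isRegularLocalRing_localRing [Fintype σ] {S U : Set (σ → ℂ)} {p : σ → ℂ} (hpS : p ∈ S)
    (hU : IsOpen[zariskiTopology σ] U) (hpU : p ∈ U) {ι : Type*} [Fintype ι]
    (f : ι → MvPolynomial σ ℂ)
    (hS : ∀ x ∈ U, x ∈ S ↔ ∀ j, eval x (f j) = 0)
    (hjac : ∀ t : ι → ℂ, ∃ δ : σ → ℂ, ∀ j, ∑ a, δ a * eval p (pderiv a (f j)) = t j) :
    IsRegularLocalRing (LocalRing S p) ∧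
      ringKrullDim (LocalRing S p) + Fintype.card ι = Fintype.card σ := by
  classical
  set M : Ideal (MvPolynomial σ ℂ) := vanishingIdeal ℂ {p} with hM
  have hMmem : ∀ F, F ∈ M ↔ eval p F = 0 := fun F => by
    rw [hM, mem_vanishingIdeal_singleton_iff, aeval_eq_eval]
  let O := AffineLocalRing p
  have hunit : ∀ s : MvPolynomial σ ℂ, eval p s ≠ 0 → IsUnit (algebraMap _ O s) := fun s hs =>
    IsLocalization.map_units O (⟨s, fun h => hs ((hMmem s).1 h)⟩ : M.primeCompl)
  have hfp : ∀ j, eval p (f j) = 0 := (hS p hpU).1 hpS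
  have hmaxO : M.map (algebraMap _ O) = maximalIdeal O :=
    Localization.AtPrime.map_eq_maximalIdeal
  have hfm : ∀ j, algebraMap _ O (f j) ∈ maximalIdeal O := fun j => by
    rw [← hmaxO]
    exact Ideal.mem_map_of_mem _ ((hMmem _).2 (hfp j))
  -- After clearing denominators, an element of the squared maximal ideal has zero gradient at p. As
  -- the f j vanish at p, this is a linear relation among their gradients, and pairing it with a
  -- direction dual to j₀ isolates the coefficient of index j₀.
  have hind : ∀ a : ι → O, ∑ j, a j * algebraMap _ O (f j) ∈ maximalIdeal O ^ 2 →
      ∀ j, a j ∈ maximalIdeal O := by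
    intro a ha j₀
    obtain ⟨b, hb⟩ := IsLocalization.exist_integer_multiples_of_finite M.primeCompl a
    choose r hr using hb
    have h1 : algebraMap _ O (∑ j, r j * f j) ∈ (M ^ 2).map (algebraMap _ O) := by
      rw [Ideal.map_pow, hmaxO]
      have : algebraMap _ O (∑ j, r j * f j) =
          algebraMap _ O (b : MvPolynomial σ ℂ) * ∑ j, a j * algebraMap _ O (f j) := by
        rw [map_sum, Finset.mul_sum]
        refine Finset.sum_congr rfl fun j _ => ?_
        rw [map_mul, hr j, Algebra.smul_def, mul_assoc]
      rw [this]
      exact Ideal.mul_mem_left _ _ ha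
    obtain ⟨s, hsM, hs⟩ := (IsLocalization.algebraMap_mem_map_algebraMap_iff M.primeCompl O _ _).1 h1
    have hs0 : eval p s ≠ 0 := fun h => hsM ((hMmem s).2 h)
    have h2 : ∀ a, ∑ j, eval p (r j) * eval p (pderiv a (f j)) = 0 := by
      intro a
      have h3 := eval_pderiv_eq_zero_of_mem_sq p a hs
      simp only [Derivation.leibniz, map_sum, map_add, smul_eq_mul, map_mul, hfp, mul_zero,
        zero_mul, add_zero, Finset.sum_const_zero] at h3
      exact (mul_eq_zero.1 h3).resolve_left hs0
    obtain ⟨δ, hδ⟩ := hjac (Pi.single j₀ 1)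
    have h4 : eval p (r j₀) = 0 := by
      have : ∑ j, eval p (r j) * ∑ a, δ a * eval p (pderiv a (f j)) = 0 := by
        simp only [Finset.mul_sum]
        rw [Finset.sum_comm]
        refine Finset.sum_eq_zero fun a _ => ?_
        have := congrArg (δ a * ·) (h2 a)
        simp only [mul_zero, Finset.mul_sum] at this
        rw [← this]
        exact Finset.sum_congr rfl fun j _ => by ring
      simpa [hδ, Pi.single_apply] using this
    have h5 : (algebraMap _ O (b : MvPolynomial σ ℂ)) * a j₀ ∈ maximalIdeal O := by
      rw [← Algebra.smul_def, ← hr j₀, ← hmaxO]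
      exact Ideal.mem_map_of_mem _ ((hMmem _).2 h4)
    exact (Ideal.unit_mul_mem_iff_mem _ (IsLocalization.map_units O b)).1 h5
  obtain ⟨hreg, hdim⟩ := IsRegularLocalRing.quotient_span_range _ hfm hind
  obtain ⟨s, hsp, hsU⟩ := exists_ne_zero_of_isOpen hU hpU
  have hprime : (Ideal.span (Set.range fun j => algebraMap _ O (f j))).IsPrime :=
    (Ideal.Quotient.isDomain_iff_prime _).1 (@IsRegularLocalRing.isDomain _ _ hreg)
  have hspan : Ideal.span (Set.range fun j => algebraMap _ O (f j)) =
      (Ideal.span (Set.range f)).map (algebraMap _ O) := by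
    rw [Ideal.map_span, ← Set.range_comp]; rfl
  -- The polynomial s is a unit at p and vanishes outside U, so multiplying by it turns statements
  -- on U into global ones. The Nullstellensatz only yields membership in a radical; this suffices
  -- because the ideal of the f j at p is prime.
  have key : (vanishingIdeal ℂ S).map (algebraMap (MvPolynomial σ ℂ) O) =
      Ideal.span (Set.range fun j => algebraMap _ O (f j)) := by
    apply le_antisymm
    · rw [Ideal.map_le_iff_le_comap]
      intro φ hφ
      have h1 : s * φ ∈ (Ideal.span (Set.range f)).radical := by
        rw [← vanishingIdeal_zeroLocus_eq_radical (K := ℂ), zeroLocus_span]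
        intro x hx
        by_cases hxU : x ∈ U
        · have hxS : x ∈ S := (hS x hxU).2 fun j => hx _ ⟨j, rfl⟩
          rw [map_mul, hφ x hxS, mul_zero]
        · have : aeval x s = 0 := hsU x hxU
          rw [map_mul, this, zero_mul]
      obtain ⟨n, hn⟩ := h1
      have h2 : (algebraMap _ O s * algebraMap _ O φ) ^ n ∈
          Ideal.span (Set.range fun j => algebraMap _ O (f j)) := by
        rw [hspan, ← map_mul, ← map_pow]
        exact Ideal.mem_map_of_mem _ hn
      exact (Ideal.unit_mul_mem_iff_mem _ (hunit s hsp)).1 (hprime.mem_of_pow_mem _ h2)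
    · rw [Ideal.span_le]
      rintro _ ⟨j, rfl⟩
      have h1 : s * f j ∈ vanishingIdeal ℂ S := by
        intro x hx
        by_cases hxU : x ∈ U
        · have : aeval x (f j) = 0 := (hS x hxU).1 hx j
          rw [map_mul, this, mul_zero]
        · have : aeval x s = 0 := hsU x hxU
          rw [map_mul, this, zero_mul]
      have h2 := Ideal.mem_map_of_mem (algebraMap _ O) h1
      rw [map_mul] at h2
      exact (Ideal.unit_mul_mem_iff_mem _ (hunit s hsp)).1 h2
  have hdimO := ringKrullDim_affineLocalRing p
  rw [Nat.card_eq_fintype_card] at hdimO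
  rw [hdimO] at hdim
  unfold LocalRing
  rw [key]
  exact ⟨hreg, hdim⟩

/-! ### Krull dimension of a locally closed set and of its local rings -/

section Dimension

/-- The points of `S` as points of the prime spectrum. -/
def toSpec (S : Set (σ → ℂ)) (x : S) : PrimeSpectrum (MvPolynomial σ ℂ) :=
  pointToPoint (x : σ → ℂ)

theorem mem_asIdeal_toSpec {S : Set (σ → ℂ)} (x : S) (F : MvPolynomial σ ℂ) :
    F ∈ (toSpec S x).asIdeal ↔ eval (x : σ → ℂ) F = 0 := by
  change F ∈ vanishingIdeal ℂ {(x : σ → ℂ)} ↔ _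
  rw [mem_vanishingIdeal_singleton_iff, aeval_eq_eval]

theorem mem_vanishingIdeal_toSpec {S : Set (σ → ℂ)} (Z : Set S) (F : MvPolynomial σ ℂ) :
    F ∈ PrimeSpectrum.vanishingIdeal (toSpec S '' Z) ↔ ∀ x ∈ Z, eval (x : σ → ℂ) F = 0 := by
  rw [PrimeSpectrum.mem_vanishingIdeal]
  constructor
  · exact fun h x hx => (mem_asIdeal_toSpec x F).1 (h _ ⟨x, hx, rfl⟩)
  · rintro h _ ⟨x, hx, rfl⟩
    exact (mem_asIdeal_toSpec x F).2 (h x hx)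

/-- The Zariski topology of a subset of an affine space. -/
abbrev subsetTopology (S : Set (σ → ℂ)) : TopologicalSpace S :=
  TopologicalSpace.induced (Subtype.val : S → (σ → ℂ)) (zariskiTopology σ)

theorem isInducing_toSpec (S : Set (σ → ℂ)) :
    @IsInducing _ _ (subsetTopology S) _ (toSpec S) :=
  @IsInducing.mk _ _ (subsetTopology S) _ _ (by
    unfold subsetTopology zariskiTopology
    rw [induced_compose]; rfl)

/-- The canonical map from the coordinate ring of the affine space to the local ring of `S`. -/
def toLocalRing (S : Set (σ → ℂ)) (p : σ → ℂ) : MvPolynomial σ ℂ →+* LocalRing S p :=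
  (Ideal.Quotient.mk _).comp (algebraMap _ (AffineLocalRing p))

theorem comap_toLocalRing_le_iff {S : Set (σ → ℂ)} {p : σ → ℂ}
    (q q' : PrimeSpectrum (LocalRing S p)) :
    q.asIdeal.comap (toLocalRing S p) ≤ q'.asIdeal.comap (toLocalRing S p) ↔ q ≤ q' := by
  rw [← PrimeSpectrum.asIdeal_le_asIdeal]
  refine ⟨fun h => ?_, Ideal.comap_mono⟩
  unfold toLocalRing at h
  rw [← Ideal.comap_comap, ← Ideal.comap_comap] at h
  have h2 := (IsLocalization.orderEmbedding
    (vanishingIdeal ℂ {p} : Ideal (MvPolynomial σ ℂ)).primeCompl (AffineLocalRing p)).le_iff_le.1 h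
  exact (Ideal.comap_le_comap_iff_of_surjective _ Ideal.Quotient.mk_surjective _ _).1 h2

theorem exists_comap_toLocalRing {S : Set (σ → ℂ)} {p : σ → ℂ} (P : Ideal (MvPolynomial σ ℂ))
    [P.IsPrime] (hS : vanishingIdeal ℂ S ≤ P) (hp : P ≤ vanishingIdeal ℂ {p}) :
    ∃ q : PrimeSpectrum (LocalRing S p), q.asIdeal.comap (toLocalRing S p) = P := by
  have hdisj : Disjoint ((vanishingIdeal ℂ {p} : Ideal (MvPolynomial σ ℂ)).primeCompl : Set _)
      (P : Set (MvPolynomial σ ℂ)) :=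
    Set.disjoint_left.2 fun x hx hx' => hx (hp hx')
  have hP' := IsLocalization.isPrime_of_isPrime_disjoint _ (AffineLocalRing p) P ‹_› hdisj
  have hcomap := IsLocalization.under_map_of_isPrime_disjoint _ (AffineLocalRing p) ‹P.IsPrime› hdisj
  have hle : (vanishingIdeal ℂ S).map (algebraMap _ (AffineLocalRing p)) ≤
      P.map (algebraMap _ (AffineLocalRing p)) := Ideal.map_mono hS
  refine ⟨⟨(P.map (algebraMap _ (AffineLocalRing p))).map (Ideal.Quotient.mk _),
    Ideal.isPrime_map_quotientMk_of_isPrime hle⟩, ?_⟩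
  unfold toLocalRing
  rw [← Ideal.comap_comap]
  dsimp only
  rw [Ideal.comap_map_of_surjective _ Ideal.Quotient.mk_surjective, ← RingHom.ker_eq_comap_bot,
    Ideal.mk_ker, sup_eq_left.2 hle]
  exact hcomap

theorem le_comap_toLocalRing {S : Set (σ → ℂ)} {p : σ → ℂ} (q : PrimeSpectrum (LocalRing S p)) :
    vanishingIdeal ℂ S ≤ q.asIdeal.comap (toLocalRing S p) := by
  intro F hF
  have : toLocalRing S p F = 0 := Ideal.Quotient.eq_zero_iff_mem.2 (Ideal.mem_map_of_mem _ hF)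
  rw [Ideal.mem_comap, this]
  exact zero_mem _

theorem comap_toLocalRing_le {S : Set (σ → ℂ)} {p : σ → ℂ} (q : PrimeSpectrum (LocalRing S p)) :
    q.asIdeal.comap (toLocalRing S p) ≤ vanishingIdeal ℂ {p} := by
  intro F hF
  by_contra hcon
  have h1 : IsUnit (toLocalRing S p F) :=
    (IsLocalization.map_units (AffineLocalRing p)
      (⟨F, hcon⟩ : (vanishingIdeal ℂ {p} : Ideal (MvPolynomial σ ℂ)).primeCompl)).map (Ideal.Quotient.mk _)
  exact q.2.ne_top (Ideal.eq_top_of_isUnit_mem _ hF h1)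

/-- A point p of the smallest member of a chain of irreducible closed sets lies in all of them.
Their vanishing ideals form a reversed chain of primes between the ideal of S and that of p, that
is, of primes of the local ring at p. -/
theorem krullDim_le_of_isEquidimensional {S : Set (σ → ℂ)} {d : ℕ} (hd : IsEquidimensional S d) :
    dimension S ≤ d := by
  let _ := subsetTopology S
  have hind := isInducing_toSpec S
  refine iSup_le fun L => ?_
  obtain ⟨p, hp⟩ := (L 0).isIrreducible.nonempty
  have hpL : ∀ k, p ∈ L k := fun k => L.monotone (Fin.zero_le k) hp
  let I : Fin (L.length + 1) → Ideal (MvPolynomial σ ℂ) := fun k =>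
    PrimeSpectrum.vanishingIdeal (toSpec S '' (L k : Set S))
  have hI : ∀ k, (I k).IsPrime := fun k =>
    PrimeSpectrum.isIrreducible_iff_vanishingIdeal_isPrime.1
      (hind.isIrreducible_image_iff.2 (L k).isIrreducible)
  have hrec : ∀ k, (L k : Set S) = toSpec S ⁻¹' PrimeSpectrum.zeroLocus (I k) := fun k => by
    rw [PrimeSpectrum.zeroLocus_vanishingIdeal_eq_closure, ← hind.closure_eq_preimage_closure_image,
      (L k).isClosed.closure_eq]
  have hIS : ∀ k, vanishingIdeal ℂ S ≤ I k := fun k F hF =>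
    (mem_vanishingIdeal_toSpec _ F).2 fun x _ => hF x x.2
  have hIp : ∀ k, I k ≤ vanishingIdeal ℂ {(p : σ → ℂ)} := fun k F hF => by
    rw [mem_vanishingIdeal_singleton_iff]
    exact (mem_vanishingIdeal_toSpec _ F).1 hF p (hpL k)
  choose q hq using fun k => exists_comap_toLocalRing (I k) (hIS k) (hIp k)
  let L' : LTSeries (PrimeSpectrum (LocalRing S p))ᵒᵈ :=
    LTSeries.mk L.length (fun k => OrderDual.toDual (q k)) (by
      intro k l hkl
      rw [OrderDual.toDual_lt_toDual, lt_iff_le_not_ge, ← comap_toLocalRing_le_iff,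
        ← comap_toLocalRing_le_iff, hq, hq]
      have hlt := L.strictMono hkl
      refine ⟨PrimeSpectrum.vanishingIdeal_anti_mono (Set.image_mono hlt.le), fun hle => ?_⟩
      refine hlt.not_ge ?_
      change (L l : Set S) ⊆ L k
      rw [hrec k, hrec l]
      exact Set.preimage_mono (PrimeSpectrum.zeroLocus_anti_mono hle))
  have h1 := Order.LTSeries.length_le_krullDim L'
  rw [Order.krullDim_orderDual] at h1
  exact h1.trans (hd p p.2).le

/-- A locally closed set is open in its closure; s defines a basic open neighbourhood of p on which
the two agree. -/
theorem exists_inter_subset {S : Set (σ → ℂ)} (hS : IsQuasiAffine S) {p : σ → ℂ} (hp : p ∈ S) :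
    ∃ s : MvPolynomial σ ℂ, eval p s ≠ 0 ∧
      ∀ x ∈ zeroLocus ℂ (vanishingIdeal ℂ S), eval x s ≠ 0 → x ∈ S := by
  obtain ⟨U, Z, hU, hZ, rfl⟩ := hS
  obtain ⟨s, hs, hsU⟩ := exists_ne_zero_of_isOpen hU hp.1
  obtain ⟨I, rfl⟩ := (isClosed_zariski_iff _).1 hZ
  refine ⟨s, hs, fun x hx hxs => ⟨?_, ?_⟩⟩
  · by_contra hxU
    exact hxs (hsU x hxU)
  · exact fun F hF => hx F fun y hy => hy.2 F hF

theorem le_krullDim_of_isEquidimensional [Finite σ] {S : Set (σ → ℂ)} (hS : IsQuasiAffine S)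
    (hne : S.Nonempty) {d : ℕ} (hd : IsEquidimensional S d) : d ≤ dimension S := by
  let _ := subsetTopology S
  have hind := isInducing_toSpec S
  obtain ⟨p, hp⟩ := hne
  obtain ⟨s, hsp, hs⟩ := exists_inter_subset hS hp
  rw [← hd p hp]
  let P : PrimeSpectrum (LocalRing S p) → Ideal (MvPolynomial σ ℂ) := fun q =>
    q.asIdeal.comap (toLocalRing S p)
  have hP : ∀ q, (P q).IsPrime := fun q => Ideal.comap_isPrime _ _
  let Z : PrimeSpectrum (LocalRing S p) → Set S := fun q =>
    toSpec S ⁻¹' PrimeSpectrum.zeroLocus (P q)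
  have hZmem : ∀ q (x : S), x ∈ Z q ↔ ∀ F ∈ P q, eval (x : σ → ℂ) F = 0 := fun q x => by
    simp only [Z, Set.mem_preimage, PrimeSpectrum.mem_zeroLocus]
    exact forall₂_congr fun F _ => mem_asIdeal_toSpec x F
  have hIZ : ∀ q, PrimeSpectrum.vanishingIdeal (toSpec S '' Z q) = P q := by
    intro q
    ext F
    rw [mem_vanishingIdeal_toSpec]
    refine ⟨fun h => ?_, fun h x hx => (hZmem q x).1 hx F h⟩
    -- A point of the zero locus of P q outside S is a zero of s, so s F vanishes on the whole
    -- locus. The factor s is then removed: P q lies in the ideal of p, where s does not vanish.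
    have h1 : s * F ∈ P q := by
      have := hP q
      rw [← IsPrime.vanishingIdeal_zeroLocus (K := ℂ) (P q)]
      intro x hx
      by_cases hxs : eval x s = 0
      · rw [map_mul, aeval_eq_eval, hxs, zero_mul]
      · have hxS := hs x (zeroLocus_anti_mono (le_comap_toLocalRing q) hx) hxs
        rw [map_mul, aeval_eq_eval, h ⟨x, hxS⟩ ((hZmem q _).2 hx), mul_zero]
    refine ((hP q).mem_or_mem h1).resolve_left fun h2 => hsp ?_
    exact comap_toLocalRing_le q h2 p rfl
  have hZirr : ∀ q, IsIrreducible (Z q) := fun q => by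
    rw [← hind.isIrreducible_image_iff, PrimeSpectrum.isIrreducible_iff_vanishingIdeal_isPrime, hIZ]
    exact hP q
  have hZcl : ∀ q, IsClosed (Z q) := fun q =>
    (PrimeSpectrum.isClosed_zeroLocus _).preimage hind.continuous
  rw [ringKrullDim, ← Order.krullDim_orderDual]
  refine Order.krullDim_le_of_strictMono (β := TopologicalSpace.IrreducibleCloseds S)
    (fun q => ⟨Z (OrderDual.ofDual q), hZirr _, hZcl _⟩) ?_
  intro q q' hlt
  rw [← OrderDual.ofDual_lt_ofDual, lt_iff_le_not_ge] at hlt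
  rw [lt_iff_le_not_ge]
  refine ⟨?_, fun hle => hlt.2 ?_⟩
  · change Z (OrderDual.ofDual q) ⊆ Z (OrderDual.ofDual q')
    exact Set.preimage_mono
      (PrimeSpectrum.zeroLocus_anti_mono ((comap_toLocalRing_le_iff _ _).2 hlt.1))
  · change Z (OrderDual.ofDual q') ⊆ Z (OrderDual.ofDual q) at hle
    rw [← comap_toLocalRing_le_iff]
    change P (OrderDual.ofDual q) ≤ P (OrderDual.ofDual q')
    rw [← hIZ, ← hIZ]
    exact PrimeSpectrum.vanishingIdeal_anti_mono (Set.image_mono hle)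

theorem dimension_eq_of_isEquidimensional [Finite σ] {S : Set (σ → ℂ)} (hS : IsQuasiAffine S)
    (hne : S.Nonempty) {d : ℕ} (hd : IsEquidimensional S d) : dimension S = d :=
  le_antisymm (krullDim_le_of_isEquidimensional hd) (le_krullDim_of_isEquidimensional hS hne hd)

end Dimension

end ClassicalVariety

/-! ### First order deformations -/

section DualPolynomial

open TrivSqZeroExt

/-- The value and the directional derivative of a polynomial, as a dual number. -/
def dualEval {σ : Type*} (p δ : σ → ℂ) : MvPolynomial σ ℂ →ₐ[ℂ] DualNumber ℂ :=
  MvPolynomial.aeval fun a => inl (p a) + inr (δ a)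

theorem dualEval_eq {σ : Type*} [Fintype σ] (p δ : σ → ℂ) (F : MvPolynomial σ ℂ) :
    dualEval p δ F = inl (MvPolynomial.eval p F) +
      inr (∑ a, δ a * MvPolynomial.eval p (MvPolynomial.pderiv a F)) := by
  classical
  induction F using MvPolynomial.induction_on with
  | C c =>
    simp only [dualEval, MvPolynomial.aeval_C, MvPolynomial.eval_C, MvPolynomial.pderiv_C, map_zero,
      mul_zero, Finset.sum_const_zero, inr_zero, add_zero]
    rfl
  | add F G hF hG =>
    rw [map_add, hF, hG]
    ext <;> simp [mul_add, Finset.sum_add_distrib]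
  | mul_X F b hF =>
    rw [map_mul, hF]
    have hX : dualEval p δ (MvPolynomial.X b) = inl (p b) + inr (δ b) := by simp [dualEval]
    rw [hX]
    ext
    · simp
    · simp [MvPolynomial.pderiv_X, Pi.single_apply, mul_add, Finset.sum_add_distrib,
        apply_ite, Finset.sum_ite_eq]
      rw [add_comm, Finset.sum_mul, mul_comm]
      exact congrArg _ (Finset.sum_congr rfl fun a _ => by ring)

/-- The polynomial `a + ε b` over the dual numbers. -/
def dualPoly (a b : ℂ[X]) : (DualNumber ℂ)[X] :=
  a.map (inlHom ℂ ℂ) + C DualNumber.eps * b.map (inlHom ℂ ℂ)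

theorem coeff_dualPoly (a b : ℂ[X]) (n : ℕ) :
    (dualPoly a b).coeff n = inl (a.coeff n) + inr (b.coeff n) := by
  rw [dualPoly, coeff_add, coeff_C_mul, coeff_map, coeff_map]
  ext <;> simp [-DualNumber.inr_eq_smul_eps]

theorem dualPoly_add (a b c d : ℂ[X]) :
    dualPoly a b + dualPoly c d = dualPoly (a + c) (b + d) := by
  simp only [dualPoly, Polynomial.map_add]
  ring

theorem dualPoly_mul (a b c d : ℂ[X]) :
    dualPoly a b * dualPoly c d = dualPoly (a * c) (a * d + b * c) := by
  have h : (C DualNumber.eps * C DualNumber.eps : (DualNumber ℂ)[X]) = 0 := by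
    rw [← C_mul, DualNumber.eps_mul_eps, C_0]
  simp only [dualPoly, Polynomial.map_add, Polynomial.map_mul]
  linear_combination (b.map (inlHom ℂ ℂ)) * (d.map (inlHom ℂ ℂ)) * h

/-- A divisor without ε-part acts on both components separately, by uniqueness of quotient and
remainder. This makes it possible to differentiate equations defined through division. -/
theorem dualPoly_divMod (a b : ℂ[X]) {q : ℂ[X]} (hq : q.Monic) :
    dualPoly a b /ₘ q.map (inlHom ℂ ℂ) = dualPoly (a /ₘ q) (b /ₘ q) ∧
      dualPoly a b %ₘ q.map (inlHom ℂ ℂ) = dualPoly (a %ₘ q) (b %ₘ q) := by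
  have hdeg : ∀ r : ℂ[X], r.degree < q.degree →
      (r.map (inlHom ℂ ℂ)).degree < (q.map (inlHom ℂ ℂ)).degree := by
    intro r hr
    rw [hq.degree_map]
    exact degree_map_le.trans_lt hr
  refine div_modByMonic_unique _ _ (hq.map _) ⟨?_, ?_⟩
  · conv_rhs => rw [← modByMonic_add_div a q, ← modByMonic_add_div b q]
    simp only [dualPoly, Polynomial.map_add, Polynomial.map_mul]
    ring
  · refine (degree_add_le _ _).trans_lt (max_lt (hdeg _ (degree_modByMonic_lt _ hq)) ?_)
    refine lt_of_le_of_lt ?_ (hdeg _ (degree_modByMonic_lt b hq))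
    exact (degree_mul_le _ _).trans (by simpa using add_le_add_left degree_C_le _)

end DualPolynomial

/-! ### Polynomials with the first coefficients removed -/

/-- The polynomial `p` divided by `X ^ k`, without remainder. -/
def tail (k : ℕ) : ℂ[X] →ₗ[ℂ] ℂ[X] :=
  ({ toFun := divX, map_add' := fun _ _ => divX_add, map_smul' := fun c p => by
      rw [smul_eq_C_mul, divX_C_mul, RingHom.id_apply, smul_eq_C_mul] } : Module.End ℂ ℂ[X]) ^ k

@[simp] theorem coeff_tail (k : ℕ) (p : ℂ[X]) (n : ℕ) : (tail k p).coeff n = p.coeff (n + k) := by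
  induction k generalizing n with
  | zero => simp [tail]
  | succ k ih =>
    have : tail (k + 1) p = divX (tail k p) := by
      unfold tail
      rw [pow_succ']
      rfl
    rw [this, coeff_divX, ih, add_assoc, add_comm 1 k]

theorem X_mul_tail_succ (k : ℕ) (p : ℂ[X]) : X * tail (k + 1) p = tail k p - C (p.coeff k) := by
  ext n
  cases n with
  | zero => simp
  | succ n => simp [coeff_X_mul, add_assoc, add_comm 1 k]

theorem tail_zero (p : ℂ[X]) : tail 0 p = p := by
  ext n; simp

/-- Here `tail (j + 1) p` is the coefficient of y^j in (p(x) - p(y))/(x - y). The induction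
multiplies by X: every tail moves down one index, and the constants thrown off cancel when the order
of summation is reversed. -/
theorem sum_coeff_mul_tail_sub (p q : ℂ[X]) (n : ℕ) :
    ∑ j ∈ Finset.range n,
      (C (q.coeff (n - 1 - j)) * tail (j + 1) p - C (p.coeff (n - 1 - j)) * tail (j + 1) q) =
      q * tail n p - p * tail n q := by
  induction n with
  | zero => simp [tail_zero, mul_comm]
  | succ n ih =>
    apply mul_left_cancel₀ (X_ne_zero (R := ℂ))
    have h0 : ∑ j ∈ Finset.range (n + 1),
        (C (q.coeff (n - j)) * C (p.coeff j) - C (p.coeff (n - j)) * C (q.coeff j)) = 0 := by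
      rw [Finset.sum_sub_distrib, sub_eq_zero, ← Finset.sum_range_reflect]
      refine Finset.sum_congr rfl fun j hj => ?_
      have hj' : j ≤ n := by simpa [Nat.lt_succ_iff] using hj
      rw [show n + 1 - 1 - j = n - j by omega, show n - (n - j) = j by omega, mul_comm]
    have h1 : X * ∑ j ∈ Finset.range (n + 1), (C (q.coeff (n + 1 - 1 - j)) * tail (j + 1) p -
          C (p.coeff (n + 1 - 1 - j)) * tail (j + 1) q) =
        ∑ j ∈ Finset.range (n + 1), (C (q.coeff (n - j)) * tail j p -
          C (p.coeff (n - j)) * tail j q) := by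
      rw [← sub_zero (∑ j ∈ Finset.range (n + 1), (C (q.coeff (n - j)) * tail j p -
          C (p.coeff (n - j)) * tail j q)), ← h0, ← Finset.sum_sub_distrib, Finset.mul_sum]
      refine Finset.sum_congr rfl fun j _ => ?_
      rw [Nat.add_sub_cancel]
      linear_combination C (q.coeff (n - j)) * X_mul_tail_succ j p -
        C (p.coeff (n - j)) * X_mul_tail_succ j q
    have h2 : ∑ j ∈ Finset.range n, (C (q.coeff (n - (j + 1))) * tail (j + 1) p -
          C (p.coeff (n - (j + 1))) * tail (j + 1) q) = q * tail n p - p * tail n q := by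
      rw [← ih]
      refine Finset.sum_congr rfl fun j _ => ?_
      rw [show n - (j + 1) = n - 1 - j by omega]
    rw [h1, Finset.sum_range_succ', h2, tail_zero, tail_zero, Nat.sub_zero]
    linear_combination -q * X_mul_tail_succ n p + p * X_mul_tail_succ n q

/-- The Bezoutian of two polynomials is symmetric. -/
theorem coeff_mul_tail_sub_comm (p q : ℂ[X]) (i k : ℕ) :
    (q * tail (i + 1) p - p * tail (i + 1) q).coeff k =
      (q * tail (k + 1) p - p * tail (k + 1) q).coeff i := by
  rw [← sum_coeff_mul_tail_sub p q (k + 1), finsetSum_coeff, coeff_sub, coeff_mul, coeff_mul,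
    Finset.Nat.sum_antidiagonal_eq_sum_range_succ_mk, Finset.Nat.sum_antidiagonal_eq_sum_range_succ_mk,
    ← Finset.sum_sub_distrib, ← Finset.sum_range_reflect]
  refine Finset.sum_congr rfl fun j hj => ?_
  have hj' : j ≤ k := by simpa [Nat.lt_succ_iff] using hj
  simp only [coeff_tail, coeff_sub, coeff_C_mul]
  rw [show k + 1 - 1 - j = k - j by omega, show k - (k - j) = j by omega,
    show j + (i + 1) = i + (j + 1) by omega]

/-! ### The Hamiltonian vector fields of the Mumford system -/

namespace Mumford

variable (g : ℕ)

section Coefficients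

variable {R S : Type*} [CommRing R] [CommRing S]

/-- The variation of `u(x)`. -/
def uTangent (c : Coord g → R) : R[X] := ∑ i : Fin g, C (c (.inl i)) * X ^ (i : ℕ)

/-- The variation of `w(x)`. -/
def wTangent (c : Coord g → R) : R[X] := ∑ i : Fin (g + 1), C (c (.inr (.inr i))) * X ^ (i : ℕ)

theorem coeff_sum_C_mul_X_pow {m : ℕ} (c : Fin m → R) (n : ℕ) :
    (∑ i : Fin m, C (c i) * X ^ (i : ℕ)).coeff n = if h : n < m then c ⟨n, h⟩ else 0 := by
  rw [finsetSum_coeff]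
  simp only [coeff_C_mul, coeff_X_pow, mul_ite, mul_one, mul_zero]
  split_ifs with h
  · rw [Finset.sum_eq_single ⟨n, h⟩] <;> simp [Fin.ext_iff]
    intro b hb h'; exact absurd h'.symm hb
  · refine Finset.sum_eq_zero fun i _ => if_neg fun h' => h (lt_of_eq_of_lt h' i.2)

theorem uPoly_map (f : R →+* S) (c : Coord g → R) : (uPoly g c).map f = uPoly g (f ∘ c) := by
  simp [uPoly, Polynomial.map_sum]

theorem vPoly_map (f : R →+* S) (c : Coord g → R) : (vPoly g c).map f = vPoly g (f ∘ c) := by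
  simp [vPoly, Polynomial.map_sum]

theorem wPoly_map (f : R →+* S) (c : Coord g → R) : (wPoly g c).map f = wPoly g (f ∘ c) := by
  simp [wPoly, Polynomial.map_sum]

theorem momentMap_eq (c : Coord g → R) :
    momentMap g c = vPoly g c ^ 2 + uPoly g c * wPoly g c := by
  simp [momentMap, laxMatrix, Matrix.det_fin_two]
  ring

theorem momentMap_map (f : R →+* S) (c : Coord g → R) :
    (momentMap g c).map f = momentMap g (f ∘ c) := by
  simp [momentMap_eq, uPoly_map, vPoly_map, wPoly_map]

theorem coeff_uPoly (c : Coord g → R) (n : ℕ) :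
    (uPoly g c).coeff n = (if n = g then 1 else 0) + if h : n < g then c (.inl ⟨n, h⟩) else 0 := by
  rw [uPoly, coeff_add, coeff_X_pow, coeff_sum_C_mul_X_pow fun i => c (.inl i)]

theorem coeff_vPoly (c : Coord g → R) (n : ℕ) :
    (vPoly g c).coeff n = if h : n < g then c (.inr (.inl ⟨n, h⟩)) else 0 := by
  rw [vPoly, coeff_sum_C_mul_X_pow fun i => c (.inr (.inl i))]

theorem coeff_wPoly (c : Coord g → R) (n : ℕ) :
    (wPoly g c).coeff n =
      (if n = g + 1 then 1 else 0) + if h : n < g + 1 then c (.inr (.inr ⟨n, h⟩)) else 0 := by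
  rw [wPoly, coeff_add, coeff_X_pow, coeff_sum_C_mul_X_pow fun i => c (.inr (.inr i))]

theorem coeff_uTangent (c : Coord g → R) (n : ℕ) :
    (uTangent g c).coeff n = if h : n < g then c (.inl ⟨n, h⟩) else 0 := by
  rw [uTangent, coeff_sum_C_mul_X_pow fun i => c (.inl i)]

theorem coeff_wTangent (c : Coord g → R) (n : ℕ) :
    (wTangent g c).coeff n = if h : n < g + 1 then c (.inr (.inr ⟨n, h⟩)) else 0 := by
  rw [wTangent, coeff_sum_C_mul_X_pow fun i => c (.inr (.inr i))]

end Coefficients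

theorem eval_uCoef (A : PhaseSpace g) (k : ℕ) :
    MvPolynomial.eval A (uCoef g k) = (uPoly g A).coeff k := by
  rw [uCoef, ← coeff_map, uPoly_map]
  congr 2; ext a; simp

theorem eval_vCoef (A : PhaseSpace g) (k : ℕ) :
    MvPolynomial.eval A (vCoef g k) = (vPoly g A).coeff k := by
  rw [vCoef, ← coeff_map, vPoly_map]
  congr 2; ext a; simp

theorem eval_wCoef (A : PhaseSpace g) (k : ℕ) :
    MvPolynomial.eval A (wCoef g k) = (wPoly g A).coeff k := by
  rw [wCoef, ← coeff_map, wPoly_map]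
  congr 2; ext a; simp

variable (A δ : PhaseSpace g)

theorem uPoly_map_dualEval :
    (uPoly g MvPolynomial.X).map (dualEval A δ : Functions g →+* DualNumber ℂ) =
      dualPoly (uPoly g A) (uTangent g δ) := by
  rw [uPoly_map]
  ext n <;> rw [coeff_dualPoly, coeff_uPoly, coeff_uPoly, coeff_uTangent] <;>
    split_ifs <;> simp [dualEval]

theorem vPoly_map_dualEval :
    (vPoly g MvPolynomial.X).map (dualEval A δ : Functions g →+* DualNumber ℂ) =
      dualPoly (vPoly g A) (vPoly g δ) := by
  rw [vPoly_map]
  ext n <;> rw [coeff_dualPoly, coeff_vPoly, coeff_vPoly, coeff_vPoly] <;>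
    split_ifs <;> simp [dualEval]

theorem wPoly_map_dualEval :
    (wPoly g MvPolynomial.X).map (dualEval A δ : Functions g →+* DualNumber ℂ) =
      dualPoly (wPoly g A) (wTangent g δ) := by
  rw [wPoly_map]
  ext n <;> rw [coeff_dualPoly, coeff_wPoly, coeff_wPoly, coeff_wTangent] <;>
    split_ifs <;> simp [dualEval]

/-- The derivative of the moment map at `A` in the direction `δ`. -/
def momentMapDeriv : ℂ[X] :=
  2 * vPoly g A * vPoly g δ + uPoly g A * wTangent g δ + wPoly g A * uTangent g δ

theorem momentMap_map_dualEval :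
    (momentMap g MvPolynomial.X).map (dualEval A δ : Functions g →+* DualNumber ℂ) =
      dualPoly (momentMap g A) (momentMapDeriv g A δ) := by
  rw [momentMap_eq, Polynomial.map_add, Polynomial.map_mul, Polynomial.map_pow, uPoly_map_dualEval,
    vPoly_map_dualEval, wPoly_map_dualEval, pow_two, dualPoly_mul, dualPoly_mul, dualPoly_add,
    momentMap_eq, momentMapDeriv]
  congr 1 <;> ring

theorem sum_mul_eval_pderiv_coeff {P : (Functions g)[X]} {a b : ℂ[X]}
    (h : P.map (dualEval A δ : Functions g →+* DualNumber ℂ) = dualPoly a b) (n : ℕ) :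
    ∑ c, δ c * MvPolynomial.eval A (MvPolynomial.pderiv c (P.coeff n)) = b.coeff n := by
  have h1 := congrArg (fun p => TrivSqZeroExt.snd (coeff p n)) h
  simp only [coeff_map, coeff_dualPoly, RingHom.coe_coe, dualEval_eq] at h1
  simpa using h1

/-- Bracketing with a coordinate is differentiation along the corresponding row of the Poisson
matrix, so a single directional derivative of the moment map yields this component for all k at
once. -/
theorem vectorField_eq (k : ℕ) (a : Coord g) :
    vectorField g k A a =
      (momentMapDeriv g A fun b => MvPolynomial.eval A (coordBracket g a b)).coeff k := by
  rw [← sum_mul_eval_pderiv_coeff g A _ (momentMap_map_dualEval g A _)]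
  simp only [vectorField, poissonBracket, map_sum, map_mul]
  rw [Finset.sum_eq_single a]
  · simp [hamiltonian]
  · intro b _ hb
    simp [MvPolynomial.pderiv_X_of_ne hb.symm]
  · simp

/-- The components of the vector field `D_k`, as polynomials. -/
def uField (k : ℕ) : ℂ[X] :=
  2 * (vPoly g A * tail (k + 1) (uPoly g A) - uPoly g A * tail (k + 1) (vPoly g A))

/-- The components of the vector field `D_k`, as polynomials. -/
def vField (k : ℕ) : ℂ[X] :=
  uPoly g A * tail (k + 1) (wPoly g A) - wPoly g A * tail (k + 1) (uPoly g A) -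
    C ((uPoly g A).coeff k) * uPoly g A

/-- The components of the vector field `D_k`, as polynomials. -/
def wField (k : ℕ) : ℂ[X] :=
  2 * (wPoly g A * tail (k + 1) (vPoly g A) - vPoly g A * tail (k + 1) (wPoly g A) +
    C ((uPoly g A).coeff k) * vPoly g A)

theorem coeff_two_mul (p : ℂ[X]) (n : ℕ) : (2 * p).coeff n = 2 * p.coeff n := by
  rw [show (2 : ℂ[X]) = C 2 from rfl, coeff_C_mul]

/-- The derivative of the moment map gives the coefficient of x^k in an expression in the tails of
order i + 1; symmetry of the Bezoutian exchanges i and k. The other two components are treated in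
the same way. -/
theorem vectorField_inl (k : ℕ) (i : Fin g) :
    vectorField g k A (.inl i) = (uField g A k).coeff i := by
  rw [vectorField_eq, momentMapDeriv, uField, coeff_two_mul, ← coeff_mul_tail_sub_comm,
    ← coeff_two_mul]
  congr 1
  have h1 : uTangent g (fun b => MvPolynomial.eval A (coordBracket g (.inl i) b)) = 0 := by
    ext n; rw [coeff_uTangent]; split_ifs <;> simp [coordBracket]
  have h2 : vPoly g (fun b => MvPolynomial.eval A (coordBracket g (.inl i) b)) =
      tail (i + 1) (uPoly g A) := by
    ext n
    rw [coeff_vPoly, coeff_tail]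
    split_ifs with h
    · simp only [coordBracket, eval_uCoef]
      congr 1; omega
    · rw [coeff_uPoly, if_neg (by omega), dif_neg (by omega), add_zero]
  have h3 : wTangent g (fun b => MvPolynomial.eval A (coordBracket g (.inl i) b)) =
      -(2 * tail (i + 1) (vPoly g A)) := by
    ext n
    rw [coeff_wTangent, coeff_neg, coeff_two_mul, coeff_tail]
    split_ifs with h
    · simp only [coordBracket, map_mul, map_neg, map_ofNat, eval_vCoef]
      rw [show (i : ℕ) + n + 1 = n + (i + 1) by omega]; ring
    · rw [coeff_vPoly, dif_neg (by omega)]; simp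
  rw [h1, h2, h3]
  ring

theorem vectorField_inr_inl (k : ℕ) (i : Fin g) :
    vectorField g k A (.inr (.inl i)) = (vField g A k).coeff i := by
  have hR : (vField g A k).coeff i = (uPoly g A * (tail (i + 1) (wPoly g A) -
      C ((uPoly g A).coeff i)) - wPoly g A * tail (i + 1) (uPoly g A)).coeff k := by
    rw [vField, coeff_sub, ← coeff_mul_tail_sub_comm, coeff_C_mul, mul_comm, ← coeff_mul_C,
      ← coeff_sub]
    congr 1
    ring
  rw [vectorField_eq, momentMapDeriv, hR]
  have h1 : uTangent g (fun b => MvPolynomial.eval A (coordBracket g (.inr (.inl i)) b)) =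
      -tail (i + 1) (uPoly g A) := by
    ext n
    rw [coeff_uTangent, coeff_neg, coeff_tail]
    split_ifs with h
    · simp only [coordBracket, map_neg, eval_uCoef]
      congr 2
    · rw [coeff_uPoly, if_neg (by omega), dif_neg (by omega), add_zero, neg_zero]
  have h2 : vPoly g (fun b => MvPolynomial.eval A (coordBracket g (.inr (.inl i)) b)) = 0 := by
    ext n; rw [coeff_vPoly]; split_ifs <;> simp [coordBracket]
  have h3 : wTangent g (fun b => MvPolynomial.eval A (coordBracket g (.inr (.inl i)) b)) =
      tail (i + 1) (wPoly g A) - C ((uPoly g A).coeff i) := by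
    ext n
    rw [coeff_wTangent, coeff_sub, coeff_tail, coeff_C]
    split_ifs with h h' h'
    · simp [coordBracket, eval_wCoef, eval_uCoef, h']
    · simp only [coordBracket, map_sub, eval_wCoef]
      rw [if_neg (by simpa [Fin.ext_iff] using h'), map_zero]
      congr 2; omega
    · omega
    · rw [coeff_wPoly, if_neg (by omega), dif_neg (by omega)]; simp
  rw [h1, h2, h3]
  congr 1
  ring

theorem vectorField_inr_inr (k : ℕ) (i : Fin (g + 1)) :
    vectorField g k A (.inr (.inr i)) = (wField g A k).coeff i := by
  have hR : (wField g A k).coeff i = (2 * (wPoly g A * tail (i + 1) (vPoly g A) -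
      vPoly g A * tail (i + 1) (wPoly g A) + C ((vPoly g A).coeff i) * uPoly g A)).coeff k := by
    rw [wField, coeff_two_mul, coeff_add, ← coeff_mul_tail_sub_comm, coeff_C_mul, coeff_two_mul,
      coeff_add, coeff_C_mul, mul_comm ((uPoly g A).coeff k)]
  rw [vectorField_eq, momentMapDeriv, hR]
  have h1 : uTangent g (fun b => MvPolynomial.eval A (coordBracket g (.inr (.inr i)) b)) =
      2 * tail (i + 1) (vPoly g A) := by
    ext n
    rw [coeff_uTangent, coeff_two_mul, coeff_tail]
    split_ifs with h
    · simp only [coordBracket, map_mul, map_ofNat, eval_vCoef]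
      congr 2
    · rw [coeff_vPoly, dif_neg (by omega), mul_zero]
  have h2 : vPoly g (fun b => MvPolynomial.eval A (coordBracket g (.inr (.inr i)) b)) =
      (if i = 0 then uPoly g A else 0) - tail (i + 1) (wPoly g A) := by
    ext n
    rw [coeff_vPoly, coeff_sub, coeff_tail]
    split_ifs with h h' h'
    · simp [coordBracket, eval_wCoef, eval_uCoef, h']
    · simp only [coordBracket, map_sub, map_neg, eval_wCoef]
      rw [if_neg h', map_zero, coeff_zero]
      simp only [add_assoc]; ring
    -- For i = 0 and n = g the leading coefficients u_g = w_{g+1} = 1 cancel.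
    · subst h'
      rw [coeff_uPoly, coeff_wPoly]
      simp only [Fin.val_zero, zero_add, Nat.add_right_cancel_iff]
      rw [dif_neg h, dif_neg (by omega)]; simp
    · have : (i : ℕ) ≠ 0 := fun h0 => h' (Fin.ext h0)
      rw [coeff_wPoly, if_neg (by omega), dif_neg (by omega)]; simp
  have h3 : wTangent g (fun b => MvPolynomial.eval A (coordBracket g (.inr (.inr i)) b)) =
      2 * (C ((vPoly g A).coeff i) - if i = 0 then vPoly g A else 0) := by
    ext n
    rw [coeff_wTangent, coeff_two_mul, coeff_sub, coeff_C]
    by_cases h : n < g + 1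
    · rw [dif_pos h]
      by_cases h' : n = 0 <;> by_cases h'' : i = 0 <;>
        simp [coordBracket, eval_vCoef, h', h'', Fin.ext_iff]
    · rw [dif_neg h, if_neg (by omega)]
      split_ifs
      · rw [coeff_vPoly, dif_neg (by omega)]; simp
      · simp
  rw [h1, h2, h3]
  congr 1
  split_ifs <;> ring

end Mumford

/-! ### Rank of the Hamiltonian vector fields -/

namespace Mumford

variable (g : ℕ) (A : PhaseSpace g)

theorem uPoly_monic : (uPoly g A).Monic := by
  refine monic_X_pow_add ?_
  rw [degree_lt_iff_coeff_zero]
  intro m hm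
  rw [coeff_sum_C_mul_X_pow fun i => A (.inl i), dif_neg (by omega)]

theorem natDegree_uPoly : (uPoly g A).natDegree = g := by
  refine natDegree_eq_of_le_of_coeff_ne_zero ?_ ?_
  · rw [natDegree_le_iff_coeff_eq_zero]
    intro m hm
    rw [coeff_uPoly, if_neg (by omega), dif_neg (by omega), add_zero]
  · rw [coeff_uPoly]; simp

theorem wPoly_monic : (wPoly g A).Monic := by
  refine monic_X_pow_add ?_
  rw [degree_lt_iff_coeff_zero]
  intro m hm
  rw [coeff_sum_C_mul_X_pow fun i => A (.inr (.inr i)), dif_neg (by omega)]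

theorem natDegree_wPoly : (wPoly g A).natDegree = g + 1 := by
  refine natDegree_eq_of_le_of_coeff_ne_zero ?_ ?_
  · rw [natDegree_le_iff_coeff_eq_zero]
    intro m hm
    rw [coeff_wPoly, if_neg (by omega), dif_neg (by omega), add_zero]
  · rw [coeff_wPoly]; simp

theorem degree_vPoly_lt : (vPoly g A).degree < g := by
  rw [degree_lt_iff_coeff_zero]
  intro m hm
  rw [coeff_vPoly, dif_neg (by omega)]

theorem tail_uPoly_eq_zero {n : ℕ} (hn : g < n) : tail n (uPoly g A) = 0 := by
  ext m
  rw [coeff_tail, coeff_uPoly, if_neg (by omega), dif_neg (by omega)]; simp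

theorem tail_vPoly_eq_zero {n : ℕ} (hn : g ≤ n) : tail n (vPoly g A) = 0 := by
  ext m
  rw [coeff_tail, coeff_vPoly, dif_neg (by omega)]; simp

theorem tail_wPoly_eq_zero {n : ℕ} (hn : g + 1 < n) : tail n (wPoly g A) = 0 := by
  ext m
  rw [coeff_tail, coeff_wPoly, if_neg (by omega), dif_neg (by omega)]; simp

theorem tail_wPoly_eq_one : tail (g + 1) (wPoly g A) = 1 := by
  ext m
  rw [coeff_tail, coeff_wPoly, dif_neg (by omega), coeff_one]; simp

theorem coeff_uField_eq_zero (k : ℕ) {n : ℕ} (hn : g ≤ n) : (uField g A k).coeff n = 0 := by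
  rw [uField, coeff_two_mul, ← coeff_mul_tail_sub_comm, tail_uPoly_eq_zero g A (by omega),
    tail_vPoly_eq_zero g A (by omega)]
  simp

theorem coeff_vField_eq_zero (k : ℕ) {n : ℕ} (hn : g ≤ n) : (vField g A k).coeff n = 0 := by
  rw [vField, coeff_sub, ← coeff_mul_tail_sub_comm, tail_uPoly_eq_zero g A (by omega), coeff_C_mul]
  -- In degree g the two surviving terms cancel, since the tail of w is 1 and u has leading
  -- coefficient 1.
  rcases hn.eq_or_lt with rfl | hn
  · rw [tail_wPoly_eq_one, coeff_uPoly (n := g)]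
    simp
  · rw [tail_wPoly_eq_zero g A (by omega), coeff_uPoly (n := n), if_neg (by omega),
      dif_neg (by omega)]
    simp

theorem coeff_wField_eq_zero (k : ℕ) {n : ℕ} (hn : g + 1 ≤ n) : (wField g A k).coeff n = 0 := by
  rw [wField, coeff_two_mul, coeff_add, ← coeff_mul_tail_sub_comm, tail_vPoly_eq_zero g A (by omega),
    tail_wPoly_eq_zero g A (by omega), coeff_C_mul, coeff_vPoly, dif_neg (by omega)]
  simp

variable {g}

/-- The functional `x ^ k ↦ c k` on polynomials. -/
def functional (c : Fin g → ℂ) : ℂ[X] →ₗ[ℂ] ℂ := ∑ k, c k • lcoeff ℂ k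

/-- The polynomial obtained by applying the functional `y ^ k ↦ c k` to `(p(x) - p(y)) / (x - y)`. -/
def contraction (c : Fin g → ℂ) : ℂ[X] →ₗ[ℂ] ℂ[X] := ∑ k, c k • tail (k + 1)

theorem functional_apply (c : Fin g → ℂ) (p : ℂ[X]) :
    functional c p = ∑ k, c k * p.coeff k := by
  simp [functional, LinearMap.sum_apply]

theorem contraction_apply (c : Fin g → ℂ) (p : ℂ[X]) :
    contraction c p = ∑ k, C (c k) * tail (k + 1) p := by
  simp [contraction, LinearMap.sum_apply, smul_eq_C_mul]

theorem contraction_X_mul (c : Fin g → ℂ) (p : ℂ[X]) :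
    contraction c (X * p) = X * contraction c p + C (functional c p) := by
  rw [contraction_apply, contraction_apply, functional_apply, map_sum, Finset.mul_sum,
    ← Finset.sum_add_distrib]
  refine Finset.sum_congr rfl fun k _ => ?_
  have h : tail (k + 1) (X * p) = tail k p := by
    ext n
    rw [coeff_tail, coeff_tail, ← add_assoc, coeff_X_mul]
  rw [h, C_mul]
  linear_combination -C (c k) * X_mul_tail_succ k p

theorem functional_mul_eq {c : Fin g → ℂ} {q : ℂ[X]} {m : ℕ}
    (hc : ∀ j < m, functional c (X ^ j * q) = 0) {p : ℂ[X]} (hp : p.natDegree ≤ m) :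
    functional c (p * q) = p.coeff m * functional c (X ^ m * q) := by
  conv_lhs => rw [p.as_sum_range_C_mul_X_pow' (n := m + 1) (by omega)]
  rw [Finset.sum_mul, map_sum, Finset.sum_range_succ, Finset.sum_eq_zero, zero_add, mul_assoc,
    ← smul_eq_C_mul, map_smul, smul_eq_mul]
  intro j hj
  rw [mul_assoc, ← smul_eq_C_mul, map_smul, hc j (Finset.mem_range.1 hj), smul_zero]

/-- By `contraction_X_mul`, contraction fails to commute with X only by a value of the functional.
The hypothesis kills all these values up to X^(m-1) q, so a factor of degree m + 1 leaves a single
constant defect. -/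
theorem contraction_mul_eq {c : Fin g → ℂ} {q : ℂ[X]} {m : ℕ}
    (hc : ∀ j < m, functional c (X ^ j * q) = 0) {p : ℂ[X]} (hp : p.natDegree ≤ m + 1) :
    contraction c (p * q) =
      p * contraction c q + C (p.coeff (m + 1) * functional c (X ^ m * q)) := by
  induction m generalizing p with
  | zero =>
    have hp' : p = X * C (p.coeff 1) + C (p.coeff 0) := by
      rw [mul_comm]; exact eq_X_add_C_of_natDegree_le_one hp
    have h1 : p * q = p.coeff 1 • (X * q) + p.coeff 0 • q := by
      conv_lhs => rw [hp']
      simp only [smul_eq_C_mul]; ring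
    rw [h1, map_add, map_smul, map_smul, contraction_X_mul]
    conv_rhs => rw [hp']
    simp [smul_eq_C_mul]
    ring
  | succ m ih =>
    have hdiv : p.divX.natDegree ≤ m + 1 := by rw [natDegree_divX_eq_natDegree_tsub_one]; omega
    have h1 : p * q = X * (p.divX * q) + p.coeff 0 • q := by
      conv_lhs => rw [← divX_mul_X_add p]
      simp only [smul_eq_C_mul]; ring
    have h2 : p * contraction c q =
        X * p.divX * contraction c q + C (p.coeff 0) * contraction c q := by
      conv_lhs => rw [← divX_mul_X_add p]
      ring
    rw [h1, map_add, map_smul, contraction_X_mul, ih (fun j hj => hc j (by omega)) hdiv,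
      hc m (by omega), functional_mul_eq hc hdiv, h2, coeff_divX, smul_eq_C_mul,
      mul_zero, C_0, add_zero]
    ring

variable (A : PhaseSpace g)

/-- This and the next two sums are, up to scalars, the 2×2 minors of (u, v, w) against the
contracted triple, with the contraction of w corrected by the constant `functional c (uPoly g A)`.
-/
theorem sum_uField (c : Fin g → ℂ) : ∑ k : Fin g, C (c k) * uField g A k =
    2 * (vPoly g A * contraction c (uPoly g A) - uPoly g A * contraction c (vPoly g A)) := by
  simp only [contraction_apply, Finset.mul_sum, ← Finset.sum_sub_distrib, uField]
  exact Finset.sum_congr rfl fun k _ => by ring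

theorem sum_vField (c : Fin g → ℂ) : ∑ k : Fin g, C (c k) * vField g A k =
    uPoly g A * (contraction c (wPoly g A) - C (functional c (uPoly g A))) -
      wPoly g A * contraction c (uPoly g A) := by
  simp only [contraction_apply, functional_apply, map_sum, mul_sub, Finset.mul_sum,
    ← Finset.sum_sub_distrib, vField]
  exact Finset.sum_congr rfl fun k _ => by rw [C_mul]; ring

theorem sum_wField (c : Fin g → ℂ) : ∑ k : Fin g, C (c k) * wField g A k =
    2 * (wPoly g A * contraction c (vPoly g A) -
      vPoly g A * (contraction c (wPoly g A) - C (functional c (uPoly g A)))) := by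
  simp only [contraction_apply, functional_apply, map_sum, mul_sub, Finset.mul_sum,
    ← Finset.sum_sub_distrib, wField]
  exact Finset.sum_congr rfl fun k _ => by rw [C_mul]; ring

theorem sum_vectorField_eq_zero_iff (c : Fin g → ℂ) :
    ∑ k : Fin g, c k • vectorField g k A = 0 ↔
      ∑ k : Fin g, C (c k) * uField g A k = 0 ∧ ∑ k : Fin g, C (c k) * vField g A k = 0 ∧
        ∑ k : Fin g, C (c k) * wField g A k = 0 := by
  constructor
  · intro h
    refine ⟨?_, ?_, ?_⟩ <;> ext n <;> simp only [finsetSum_coeff, coeff_C_mul, coeff_zero]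
    · by_cases hn : n < g
      · simpa [vectorField_inl] using congrFun h (.inl ⟨n, hn⟩)
      · exact Finset.sum_eq_zero fun k _ => by rw [coeff_uField_eq_zero g A _ (by omega), mul_zero]
    · by_cases hn : n < g
      · simpa [vectorField_inr_inl] using congrFun h (.inr (.inl ⟨n, hn⟩))
      · exact Finset.sum_eq_zero fun k _ => by rw [coeff_vField_eq_zero g A _ (by omega), mul_zero]
    · by_cases hn : n < g + 1
      · simpa [vectorField_inr_inr] using congrFun h (.inr (.inr ⟨n, hn⟩))
      · exact Finset.sum_eq_zero fun k _ => by rw [coeff_wField_eq_zero g A _ (by omega), mul_zero]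
  · rintro ⟨hu, hv, hw⟩
    ext a
    rcases a with i | i | i
    · simpa [vectorField_inl, finsetSum_coeff] using congrArg (fun p => coeff p i) hu
    · simpa [vectorField_inr_inl, finsetSum_coeff] using congrArg (fun p => coeff p i) hv
    · simpa [vectorField_inr_inr, finsetSum_coeff] using congrArg (fun p => coeff p i) hw

/-- A factorization of `(u, v, w)` as a monic greatest common divisor `Q` times a unimodular
triple. -/
structure GcdFactorization (A : PhaseSpace g) (Q : ℂ[X]) where
  monic : Q.Monic
  (u v w a b c : ℂ[X])
  uPoly_eq : uPoly g A = Q * u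
  vPoly_eq : vPoly g A = Q * v
  wPoly_eq : wPoly g A = Q * w
  bezout : a * u + b * v + c * w = 1

theorem exists_gcdFactorization : ∃ Q, Nonempty (GcdFactorization A Q) := by
  obtain ⟨q, hq⟩ := IsPrincipalIdealRing.principal
    (Ideal.span {uPoly g A, vPoly g A, wPoly g A})
  rw [Ideal.submodule_span_eq] at hq
  have hmem : ∀ p ∈ ({uPoly g A, vPoly g A, wPoly g A} : Set ℂ[X]), q ∣ p := fun p hp => by
    rw [← Ideal.mem_span_singleton]
    rw [← hq]
    exact Ideal.subset_span hp
  have hq0 : q ≠ 0 := fun h => (uPoly_monic g A).ne_zero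
    (zero_dvd_iff.1 (h ▸ hmem _ (by simp)))
  have hlc : q.leadingCoeff ≠ 0 := leadingCoeff_ne_zero.2 hq0
  have hQ : q = C q.leadingCoeff * normalize q := by
    rw [normalize_apply, coe_normUnit_of_ne_zero hq0, mul_comm q, ← mul_assoc, ← C_mul,
      mul_inv_cancel₀ hlc, C_1, one_mul]
  obtain ⟨u, hu⟩ := normalize_dvd_iff.2 (hmem (uPoly g A) (by simp))
  obtain ⟨v, hv⟩ := normalize_dvd_iff.2 (hmem (vPoly g A) (by simp))
  obtain ⟨w, hw⟩ := normalize_dvd_iff.2 (hmem (wPoly g A) (by simp))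
  have hqm : normalize q ∈ Ideal.span {uPoly g A, vPoly g A, wPoly g A} := by
    rw [hq]
    exact Ideal.mem_span_singleton.2 (dvd_normalize_iff.2 dvd_rfl)
  obtain ⟨a, y, hy, hay⟩ := Ideal.mem_span_insert.1 hqm
  obtain ⟨b, c, hbc⟩ := Ideal.mem_span_pair.1 hy
  refine ⟨normalize q, ⟨monic_normalize hq0, u, v, w, a, b, c, hu, hv, hw, ?_⟩⟩
  apply mul_left_cancel₀ (monic_normalize hq0).ne_zero
  conv_rhs => rw [mul_one, hay, ← hbc, hu, hv, hw]
  ring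

namespace GcdFactorization

variable {A} {Q : ℂ[X]} (F : GcdFactorization A Q)
include F

theorem u_monic : F.u.Monic := F.monic.of_mul_monic_left (F.uPoly_eq ▸ uPoly_monic g A)

theorem w_monic : F.w.Monic := F.monic.of_mul_monic_left (F.wPoly_eq ▸ wPoly_monic g A)

theorem natDegree_add : Q.natDegree + F.u.natDegree = g := by
  rw [← F.monic.natDegree_mul F.u_monic, ← F.uPoly_eq, natDegree_uPoly]

theorem natDegree_w : F.w.natDegree = F.u.natDegree + 1 := by
  have h : Q.natDegree + F.w.natDegree = g + 1 := by
    rw [← F.monic.natDegree_mul F.w_monic, ← F.wPoly_eq, natDegree_wPoly]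
  have := F.natDegree_add
  omega

theorem degree_v_lt : F.v.degree < F.u.natDegree := by
  have h := degree_vPoly_lt g A
  rw [F.vPoly_eq, mul_comm, F.monic.degree_mul, degree_eq_natDegree F.monic.ne_zero] at h
  by_cases hv : F.v = 0
  · rw [hv, degree_zero]; exact WithBot.bot_lt_coe _
  · rw [degree_eq_natDegree hv] at h ⊢
    have := F.natDegree_add
    norm_cast at h ⊢
    omega

theorem dvd_of_dvd {P : ℂ[X]} (hu : P ∣ uPoly g A) (hv : P ∣ vPoly g A) (hw : P ∣ wPoly g A) :
    P ∣ Q := by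
  have h : Q = F.a * uPoly g A + F.b * vPoly g A + F.c * wPoly g A := by
    rw [F.uPoly_eq, F.vPoly_eq, F.wPoly_eq]
    linear_combination -Q * F.bezout
  rw [h]
  exact dvd_add (dvd_add (hu.mul_left _) (hv.mul_left _)) (hw.mul_left _)

/-- Under these conditions the contracted triple is the contraction of Q times (u', v', w'), so all
minors vanish. Since w' has degree one more than u', its contraction has a constant defect, which is
exactly the correction term. -/
theorem sum_vectorField_eq_zero {c : Fin g → ℂ}
    (hc : ∀ j < F.u.natDegree, functional c (X ^ j * Q) = 0) :
    ∑ k : Fin g, c k • vectorField g k A = 0 := by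
  have hv : F.v.natDegree ≤ F.u.natDegree := natDegree_le_of_degree_le F.degree_v_lt.le
  have hu0 : F.u.coeff (F.u.natDegree + 1) = 0 := coeff_eq_zero_of_natDegree_lt (by omega)
  have hv0 : F.v.coeff (F.u.natDegree + 1) = 0 := coeff_eq_zero_of_natDegree_lt (by omega)
  have hw1 : F.w.coeff (F.u.natDegree + 1) = 1 := by
    rw [← F.natDegree_w]; exact F.w_monic
  have hu1 : F.u.coeff F.u.natDegree = 1 := F.u_monic
  have hU : contraction c (uPoly g A) = F.u * contraction c Q := by
    rw [F.uPoly_eq, mul_comm, contraction_mul_eq hc (by omega), hu0]; simp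
  have hV : contraction c (vPoly g A) = F.v * contraction c Q := by
    rw [F.vPoly_eq, mul_comm, contraction_mul_eq hc (by omega), hv0]; simp
  have hW : contraction c (wPoly g A) - C (functional c (uPoly g A)) = F.w * contraction c Q := by
    rw [F.wPoly_eq, F.uPoly_eq, mul_comm, contraction_mul_eq hc F.natDegree_w.le, hw1, mul_comm Q,
      functional_mul_eq hc le_rfl, hu1]
    simp
  rw [sum_vectorField_eq_zero_iff, sum_uField, sum_vField, sum_wField, hW, hU, hV, F.uPoly_eq,
    F.vPoly_eq, F.wPoly_eq]
  refine ⟨?_, ?_, ?_⟩ <;> ring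

/-- Vanishing minors make (U, V, W) proportional to the unimodular triple (u', v', w'); the Bezout
coefficients supply the factor as aU + bV + cW. -/
theorem exists_contraction_eq {c : Fin g → ℂ} (hc : ∑ k : Fin g, c k • vectorField g k A = 0) :
    ∃ f : ℂ[X], contraction c (uPoly g A) = F.u * f := by
  obtain ⟨h1, h2, -⟩ := (sum_vectorField_eq_zero_iff A c).1 hc
  rw [sum_uField] at h1
  rw [sum_vField] at h2
  have h1' := (mul_eq_zero.1 h1).resolve_left two_ne_zero
  set U := contraction c (uPoly g A)
  set V := contraction c (vPoly g A)
  set W := contraction c (wPoly g A) - C (functional c (uPoly g A))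
  rw [F.uPoly_eq, F.vPoly_eq] at h1'
  rw [F.uPoly_eq, F.wPoly_eq] at h2
  have h3 : F.v * U = F.u * V := mul_left_cancel₀ F.monic.ne_zero (by linear_combination h1')
  have h4 : F.w * U = F.u * W := mul_left_cancel₀ F.monic.ne_zero (by linear_combination -h2)
  refine ⟨F.a * U + F.b * V + F.c * W, ?_⟩
  linear_combination -U * F.bezout + F.b * h3 + F.c * h4

end GcdFactorization

theorem coeff_contraction (c : Fin g → ℂ) (p : ℂ[X]) (n : ℕ) :
    (contraction c p).coeff n = ∑ k : Fin g, c k * p.coeff (n + (k + 1)) := by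
  simp [contraction_apply, finsetSum_coeff]

theorem degree_contraction_uPoly_lt (c : Fin g → ℂ) : (contraction c (uPoly g A)).degree < g := by
  rw [degree_lt_iff_coeff_zero]
  intro n hn
  rw [coeff_contraction]
  refine Finset.sum_eq_zero fun k _ => ?_
  rw [coeff_uPoly, if_neg (by omega), dif_neg (by omega)]
  simp

/-- As u is monic of degree g, the coefficient of index g - 1 - n equals c_n plus a combination of
the c_k with k < n: the system is unitriangular. -/
theorem eq_zero_of_contraction_uPoly_eq_zero {c : Fin g → ℂ}
    (hc : contraction c (uPoly g A) = 0) : c = 0 := by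
  have h : ∀ n, ∀ hn : n < g, c ⟨n, hn⟩ = 0 := by
    intro n
    induction n using Nat.strong_induction_on with
    | _ n ih =>
      intro hn
      have h1 := congrArg (fun p => coeff p (g - 1 - n)) hc
      simp only [coeff_contraction, coeff_zero] at h1
      rw [Finset.sum_eq_single ⟨n, hn⟩] at h1
      · rw [coeff_uPoly, if_pos (by simp only; omega), dif_neg (by simp only; omega)] at h1
        simpa using h1
      · intro k _ hk
        rcases lt_or_gt_of_ne (fun h => hk (Fin.ext h) : (k : ℕ) ≠ n) with hlt | hgt
        · rw [ih k hlt k.2, zero_mul]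
        · rw [coeff_uPoly, if_neg (by omega), dif_neg (by omega)]; simp
      · simp
  exact funext fun k => h k k.2

/-- The dimension of the span of the Hamiltonian vector fields at `A`. -/
def fieldRank (A : PhaseSpace g) : ℕ :=
  Module.finrank ℂ (Submodule.span ℂ (Set.range fun k : Fin g => vectorField g k A))

/-- The dimension of the span of the Hamiltonian vector fields is `g` minus the degree of the
greatest common divisor of `u`, `v` and `w`. -/
theorem GcdFactorization.fieldRank_eq {A : PhaseSpace g} {Q : ℂ[X]} (F : GcdFactorization A Q) :
    fieldRank A = F.u.natDegree := by
  let Φ := Fintype.linearCombination ℂ (fun k : Fin g => vectorField g k A)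
  have hΦ : ∀ c, Φ c = ∑ k : Fin g, c k • vectorField g k A := fun c => rfl
  have hrange : LinearMap.range Φ = Submodule.span ℂ (Set.range fun k : Fin g => vectorField g k A) :=
    Fintype.range_linearCombination ℂ _
  have hsum := LinearMap.finrank_range_add_finrank_ker Φ
  rw [hrange, Module.finrank_fin_fun] at hsum
  change fieldRank A + _ = g at hsum
  have hadd := F.natDegree_add
  -- The deg u' linear conditions that force the vector fields to be dependent cut out a space of
  -- dimension at least g - deg u' = deg Q.
  have hlow : Q.natDegree ≤ Module.finrank ℂ (LinearMap.ker Φ) := by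
    let L : (Fin g → ℂ) →ₗ[ℂ] (Fin F.u.natDegree → ℂ) :=
      { toFun := fun c j => functional c (X ^ (j : ℕ) * Q)
        map_add' := fun c c' => by ext j; simp [functional_apply, add_mul, Finset.sum_add_distrib]
        map_smul' := fun r c => by ext j; simp [functional_apply, mul_assoc, Finset.mul_sum] }
    have h1 := LinearMap.finrank_range_add_finrank_ker L
    have h2 : Module.finrank ℂ (LinearMap.range L) ≤ F.u.natDegree :=
      (Submodule.finrank_le _).trans (by simp)
    have h3 : LinearMap.ker L ≤ LinearMap.ker Φ := fun c hc => by
      rw [LinearMap.mem_ker, hΦ]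
      exact F.sum_vectorField_eq_zero fun j hj => congrFun (LinearMap.mem_ker.1 hc) ⟨j, hj⟩
    have h4 := Submodule.finrank_mono h3
    rw [Module.finrank_fin_fun] at h1
    omega
  -- On the kernel, the injective map c ↦ U has values u' f. As U has degree less than g, f has
  -- degree less than deg Q.
  have hupp : Module.finrank ℂ (LinearMap.ker Φ) ≤ Q.natDegree := by
    let T : (Fin g → ℂ) →ₗ[ℂ] ℂ[X] :=
      { toFun := fun c => contraction c (uPoly g A)
        map_add' := fun c c' => by simp [contraction_apply, add_mul, Finset.sum_add_distrib]
        map_smul' := fun r c => by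
          simp [contraction_apply, mul_assoc, Finset.mul_sum, smul_eq_C_mul] }
    have hT : Function.Injective T := (injective_iff_map_eq_zero T).2 fun c hc =>
      eq_zero_of_contraction_uPoly_eq_zero A hc
    have : Module.Finite ℂ (degreeLT ℂ Q.natDegree) :=
      Module.Finite.equiv (degreeLTEquiv ℂ Q.natDegree).symm
    have hle : (LinearMap.ker Φ).map T ≤
        (degreeLT ℂ Q.natDegree).map (LinearMap.mulLeft ℂ F.u) := by
      rintro _ ⟨c, hc, rfl⟩
      obtain ⟨f, hf⟩ := F.exists_contraction_eq (c := c) hc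
      refine ⟨f, ?_, hf.symm⟩
      rw [SetLike.mem_coe, mem_degreeLT]
      have hdeg := degree_contraction_uPoly_lt A c
      rw [hf, mul_comm, F.u_monic.degree_mul, degree_eq_natDegree F.u_monic.ne_zero] at hdeg
      by_cases hf0 : f = 0
      · rw [hf0, degree_zero]; exact WithBot.bot_lt_coe _
      · rw [degree_eq_natDegree hf0] at hdeg ⊢
        norm_cast at hdeg ⊢
        omega
    have h1 := LinearEquiv.finrank_eq (Submodule.equivMapOfInjective T hT (LinearMap.ker Φ))
    have h2 := Submodule.finrank_mono hle
    have h3 := Submodule.finrank_map_le (LinearMap.mulLeft ℂ F.u) (degreeLT ℂ Q.natDegree)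
    have h4 := LinearEquiv.finrank_eq (degreeLTEquiv ℂ Q.natDegree)
    rw [Module.finrank_fin_fun] at h4
    omega
  omega

end Mumford

/-! ### Semicontinuity of the rank -/

namespace ClassicalVariety

variable {σ : Type*}

/-- At p choose r independent rows and a left inverse G of their combination map. Keeping G
constant, the determinant of the images of these rows is a polynomial in x with value 1 at p, and
the rows stay independent wherever it is nonzero. -/
theorem isOpen_setOf_le_finrank_span {κ τ : Type*} [Finite κ] [Finite τ]
    (P : κ → τ → MvPolynomial σ ℂ) (r : ℕ) :
    IsOpen[zariskiTopology σ] {x | r ≤ Module.finrank ℂ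
      (Submodule.span ℂ (Set.range fun k => fun a => MvPolynomial.eval x (P k a)))} := by
  classical
  have := Fintype.ofFinite τ
  let _ := zariskiTopology σ
  rw [isOpen_iff_forall_mem_open]
  intro p hp
  obtain ⟨f, hf, -, hli⟩ := Submodule.exists_fun_fin_finrank_span_eq ℂ
    (Set.range fun k => fun a => MvPolynomial.eval p (P k a))
  choose e' he' using hf
  let e : Fin r → κ := fun k => e' (Fin.castLE hp k)
  let row : (σ → ℂ) → Fin r → τ → ℂ := fun x k a => MvPolynomial.eval x (P (e k) a)
  have hrow : LinearIndependent ℂ (row p) := by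
    have h1 : row p = f ∘ Fin.castLE hp := funext fun k => he' _
    rw [h1]
    exact hli.comp _ (Fin.castLE_injective hp)
  obtain ⟨G, hG⟩ := LinearMap.exists_leftInverse_of_injective
    (Fintype.linearCombination ℂ (row p)) (LinearMap.ker_eq_bot.2 hrow.fintypeLinearCombination_injective)
  have hG' : ∀ y : τ → ℂ, G y = fun j => ∑ a, G (Pi.single a 1) j * y a := by
    intro y
    conv_lhs => rw [pi_eq_sum_univ' y, map_sum]
    ext j
    simp [Finset.sum_apply, mul_comm]
  let M : Matrix (Fin r) (Fin r) (MvPolynomial σ ℂ) :=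
    Matrix.of fun k j => ∑ a, MvPolynomial.C (G (Pi.single a 1) j) * P (e k) a
  have hM : ∀ x, MvPolynomial.eval x M.det = (Matrix.of fun k => G (row x k)).det := by
    intro x
    rw [RingHom.map_det]
    congr 1
    ext k j
    rw [Matrix.of_apply, hG']
    simp [M, row]
  refine ⟨{x | MvPolynomial.eval x M.det ≠ 0}, ?_, isOpen_setOf_eval_ne_zero _, ?_⟩
  · intro x hx
    rw [Set.mem_ofPred_eq, hM, ← isUnit_iff_ne_zero, ← Matrix.isUnit_iff_isUnit_det,
      ← Matrix.linearIndependent_rows_iff_isUnit] at hx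
    have hli' : LinearIndependent ℂ (row x) := LinearIndependent.of_comp G hx
    have h1 := finrank_span_eq_card hli'
    rw [Fintype.card_fin] at h1
    rw [Set.mem_ofPred_eq, ← h1]
    refine Submodule.finrank_mono (Submodule.span_mono ?_)
    rintro _ ⟨k, rfl⟩
    exact ⟨e k, rfl⟩
  · rw [Set.mem_ofPred_eq, hM]
    have h1 : (Matrix.of fun k => G (row p k)) = 1 := by
      ext k j
      have h2 := LinearMap.congr_fun hG (Pi.single k 1)
      rw [LinearMap.comp_apply, Fintype.linearCombination_apply_single, one_smul] at h2
      rw [Matrix.of_apply, h2, LinearMap.id_apply, Matrix.one_apply, Pi.single_apply]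
      simp [eq_comm]
    rw [h1, Matrix.det_one]
    exact one_ne_zero

end ClassicalVariety

/-! ### A linear equation over polynomials, with degree bounds -/

namespace Polynomial

theorem degree_mul_lt_of_lt {p q : ℂ[X]} {m n k : ℕ} (hp : p.degree < m) (hq : q.degree < n)
    (h : m + n ≤ k + 1) : (p * q).degree < k := by
  by_cases hp0 : p = 0
  · rw [hp0, zero_mul, degree_zero]; exact WithBot.bot_lt_coe _
  by_cases hq0 : q = 0
  · rw [hq0, mul_zero, degree_zero]; exact WithBot.bot_lt_coe _
  rw [degree_mul, degree_eq_natDegree hp0, degree_eq_natDegree hq0]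
  rw [degree_eq_natDegree hp0] at hp
  rw [degree_eq_natDegree hq0] at hq
  norm_cast at hp hq ⊢
  omega

theorem degree_lt_of_monic_mul_lt {p q : ℂ[X]} {m k : ℕ} (hp : p.Monic)
    (h : (p * q).degree < k) (hk : k ≤ p.natDegree + m) : q.degree < m := by
  by_cases hq0 : q = 0
  · rw [hq0, degree_zero]; exact WithBot.bot_lt_coe _
  rw [degree_mul, degree_eq_natDegree hp.ne_zero, degree_eq_natDegree hq0] at h
  rw [degree_eq_natDegree hq0]
  norm_cast at h ⊢
  omega

theorem degree_add_lt_of_lt {p q : ℂ[X]} {k : ℕ} (hp : p.degree < k) (hq : q.degree < k) :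
    (p + q).degree < k :=
  (degree_add_le p q).trans_lt (max_lt hp hq)

theorem degree_lt_succ_natDegree (p : ℂ[X]) : p.degree < (p.natDegree + 1 : ℕ) :=
  degree_le_natDegree.trans_lt (by exact_mod_cast Nat.lt_succ_self _)

/-- Bezout solves the equation without degree bounds. Reducing α and β modulo the monic u moves the
quotients into γ, whose degree is then bounded by comparing the two sides. -/
theorem exists_mul_add_mul_add_mul_eq {u v w a b c P : ℂ[X]} (hu : u.Monic)
    (hv : v.degree < u.natDegree) (hw : w.natDegree = u.natDegree + 1)
    (habc : a * u + b * v + c * w = 1) (hP : P.degree < (2 * u.natDegree + 1 : ℕ)) :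
    ∃ α β γ : ℂ[X], α.degree < u.natDegree ∧ β.degree < u.natDegree ∧
      γ.degree < (u.natDegree + 1 : ℕ) ∧ 2 * v * β + u * γ + w * α = P := by
  have h2 : (2 : ℂ[X]) * C (1 / 2 : ℂ) = 1 := by
    rw [show (2 : ℂ[X]) = C 2 from rfl, ← C_mul]; norm_num
  set α₀ := c * P
  set β₀ := C (1 / 2 : ℂ) * (b * P)
  have hα := degree_modByMonic_lt α₀ hu
  have hβ := degree_modByMonic_lt β₀ hu
  rw [degree_eq_natDegree hu.ne_zero] at hα hβ
  have heq : 2 * v * (β₀ %ₘ u) + u * (a * P + w * (α₀ /ₘ u) + 2 * v * (β₀ /ₘ u)) + w * (α₀ %ₘ u) =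
      P := by
    have h3 := modByMonic_add_div α₀ u
    have h4 := modByMonic_add_div β₀ u
    linear_combination w * h3 + 2 * v * h4 + P * habc + v * b * P * h2
  refine ⟨α₀ %ₘ u, β₀ %ₘ u, _, hα, hβ, ?_, heq⟩
  refine degree_lt_of_monic_mul_lt hu (k := 2 * u.natDegree + 1) ?_ (by omega)
  have h5 : u * (a * P + w * (α₀ /ₘ u) + 2 * v * (β₀ /ₘ u)) =
      P - (C 2 * (v * (β₀ %ₘ u)) + w * (α₀ %ₘ u)) := by
    rw [show (C 2 : ℂ[X]) = 2 from rfl]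
    linear_combination heq
  rw [h5]
  refine (degree_sub_le _ _).trans_lt (max_lt hP (degree_add_lt_of_lt ?_ ?_))
  · rw [degree_C_mul two_ne_zero]
    exact degree_mul_lt_of_lt hv hβ (by omega)
  · refine degree_mul_lt_of_lt (degree_lt_succ_natDegree w) hα (by omega)

end Polynomial

/-! ### Equations of the strata -/

namespace Mumford

open ClassicalVariety

variable {g : ℕ}

section Equations

theorem map_C_map_eval (A : PhaseSpace g) (Q : ℂ[X]) :
    (Q.map MvPolynomial.C).map (MvPolynomial.eval A) = Q := by
  ext n
  simp

theorem eval_coeff_modByMonic (A : PhaseSpace g) (P : (Functions g)[X]) {Q : ℂ[X]} (hQ : Q.Monic)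
    (j : ℕ) : MvPolynomial.eval A ((P %ₘ Q.map MvPolynomial.C).coeff j) =
      ((P.map (MvPolynomial.eval A)) %ₘ Q).coeff j := by
  rw [← coeff_map, map_modByMonic _ (hQ.map _), map_C_map_eval]

theorem eval_coeff_divByMonic (A : PhaseSpace g) (P : (Functions g)[X]) {Q : ℂ[X]} (hQ : Q.Monic)
    (j : ℕ) : MvPolynomial.eval A ((P /ₘ Q.map MvPolynomial.C).coeff j) =
      ((P.map (MvPolynomial.eval A)) /ₘ Q).coeff j := by
  rw [← coeff_map, map_divByMonic _ (hQ.map _), map_C_map_eval]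

theorem map_eval_uPoly (A : PhaseSpace g) :
    (uPoly g MvPolynomial.X).map (MvPolynomial.eval A) = uPoly g A := by
  rw [uPoly_map]; congr 1; ext a; simp

theorem map_eval_vPoly (A : PhaseSpace g) :
    (vPoly g MvPolynomial.X).map (MvPolynomial.eval A) = vPoly g A := by
  rw [vPoly_map]; congr 1; ext a; simp

theorem map_eval_wPoly (A : PhaseSpace g) :
    (wPoly g MvPolynomial.X).map (MvPolynomial.eval A) = wPoly g A := by
  rw [wPoly_map]; congr 1; ext a; simp

theorem map_eval_momentMap (A : PhaseSpace g) :
    (momentMap g MvPolynomial.X).map (MvPolynomial.eval A) = momentMap g A := by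
  rw [momentMap_map]; congr 1; ext a; simp

theorem map_dualEval_map_C (A δ : PhaseSpace g) (Q : ℂ[X]) :
    (Q.map MvPolynomial.C).map (dualEval A δ : Functions g →+* DualNumber ℂ) =
      Q.map (TrivSqZeroExt.inlHom ℂ ℂ) := by
  rw [Polynomial.map_map]
  congr 1
  ext c <;> simp [dualEval, TrivSqZeroExt.algebraMap_eq_inl]

theorem map_dualEval_modByMonic {A δ : PhaseSpace g} {P : (Functions g)[X]} {a b Q : ℂ[X]}
    (hQ : Q.Monic) (h : P.map (dualEval A δ : Functions g →+* DualNumber ℂ) = dualPoly a b) :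
    (P %ₘ Q.map MvPolynomial.C).map (dualEval A δ : Functions g →+* DualNumber ℂ) =
      dualPoly (a %ₘ Q) (b %ₘ Q) := by
  rw [map_modByMonic _ (hQ.map _), h, map_dualEval_map_C, (dualPoly_divMod a b hQ).2]

theorem map_dualEval_divByMonic {A δ : PhaseSpace g} {P : (Functions g)[X]} {a b Q : ℂ[X]}
    (hQ : Q.Monic) (h : P.map (dualEval A δ : Functions g →+* DualNumber ℂ) = dualPoly a b) :
    (P /ₘ Q.map MvPolynomial.C).map (dualEval A δ : Functions g →+* DualNumber ℂ) =
      dualPoly (a /ₘ Q) (b /ₘ Q) := by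
  rw [map_divByMonic _ (hQ.map _), h, map_dualEval_map_C, (dualPoly_divMod a b hQ).1]

/-- Equations, near a point where `Q` is the greatest common divisor of `u`, `v` and `w`, for the
stratum of the fibre over `h`: the polynomial `Q` divides `u`, `v` and `w`, and the difference of the
moment map and `h` is zero. -/
def stratumEquation (h Q : ℂ[X]) (i : ℕ) :
    Fin Q.natDegree ⊕ Fin Q.natDegree ⊕ Fin Q.natDegree ⊕ Fin (2 * i + 1) → Functions g
  | .inl j => (uPoly g MvPolynomial.X %ₘ Q.map MvPolynomial.C).coeff j
  | .inr (.inl j) => (vPoly g MvPolynomial.X %ₘ Q.map MvPolynomial.C).coeff j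
  | .inr (.inr (.inl j)) => (wPoly g MvPolynomial.X %ₘ Q.map MvPolynomial.C).coeff j
  | .inr (.inr (.inr j)) =>
      ((momentMap g MvPolynomial.X - h.map MvPolynomial.C) /ₘ (Q ^ 2).map MvPolynomial.C).coeff j

end Equations

/-- The polynomial `Q` divides the entries of the Lax matrix. -/
def DividesLax (Q : ℂ[X]) (A : PhaseSpace g) : Prop :=
  Q ∣ uPoly g A ∧ Q ∣ vPoly g A ∧ Q ∣ wPoly g A

theorem DividesLax.sq_dvd {Q : ℂ[X]} {A : PhaseSpace g} (hQ : DividesLax Q A) :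
    Q ^ 2 ∣ momentMap g A := by
  obtain ⟨⟨u, hu⟩, ⟨v, hv⟩, w, hw⟩ := hQ
  exact ⟨v ^ 2 + u * w, by rw [momentMap_eq, hu, hv, hw]; ring⟩

theorem GcdFactorization.dividesLax {Q : ℂ[X]} {A : PhaseSpace g} (F : GcdFactorization A Q) :
    DividesLax Q A :=
  ⟨⟨_, F.uPoly_eq⟩, ⟨_, F.vPoly_eq⟩, ⟨_, F.wPoly_eq⟩⟩

theorem isClosed_dividesLax {Q : ℂ[X]} (hQ : Q.Monic) :
    IsClosed[zariskiTopology _] {A : PhaseSpace g | DividesLax Q A} := by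
  convert isClosed_setOf_eval_eq_zero (σ := Coord g) (ι := Fin 3 × ℕ) (fun j =>
    (![uPoly g MvPolynomial.X, vPoly g MvPolynomial.X, wPoly g MvPolynomial.X] j.1 %ₘ
      Q.map MvPolynomial.C).coeff j.2) using 1
  ext A
  simp only [Set.mem_ofPred_eq, DividesLax, eval_coeff_modByMonic A _ hQ, Prod.forall,
    Fin.forall_fin_succ, ← modByMonic_eq_zero_iff_dvd hQ, Polynomial.ext_iff]
  simp [map_eval_uPoly, map_eval_vPoly, map_eval_wPoly]

theorem isOpen_le_fieldRank (r : ℕ) :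
    IsOpen[zariskiTopology _] {A : PhaseSpace g | r ≤ fieldRank A} :=
  isOpen_setOf_le_finrank_span (fun (k : Fin g) (a : Coord g) =>
    poissonBracket g (MvPolynomial.X a) (hamiltonian g k)) r

theorem isClosed_fiber (h : ℂ[X]) : IsClosed[zariskiTopology _] (fiber g h) := by
  convert isClosed_setOf_eval_eq_zero (σ := Coord g) (fun j : ℕ =>
    (momentMap g MvPolynomial.X - h.map MvPolynomial.C).coeff j) using 1
  ext A
  have : ∀ j, MvPolynomial.eval A ((momentMap g MvPolynomial.X - h.map MvPolynomial.C).coeff j) =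
      (momentMap g A).coeff j - h.coeff j := fun j => by
    rw [coeff_sub, map_sub, ← coeff_map, map_eval_momentMap]; simp
  simp only [this, sub_eq_zero, fiber, Set.mem_ofPred_eq, Polynomial.ext_iff]

theorem isQuasiAffine_fiberStratum (i : ℕ) (h : ℂ[X]) : IsQuasiAffine (fiberStratum g i h) := by
  let _ := zariskiTopology (Coord g)
  have hS : fiberStratum g i h = {A : PhaseSpace g | i ≤ fieldRank A} ∩
      (fiber g h ∩ {A : PhaseSpace g | i + 1 ≤ fieldRank A}ᶜ) := by
    ext A
    change (A ∈ fiber g h ∧ fieldRank A = i) ↔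
      (i ≤ fieldRank A ∧ A ∈ fiber g h ∧ ¬ (i + 1 ≤ fieldRank A))
    constructor
    · rintro ⟨h1, h2⟩; exact ⟨h2.ge, h1, by omega⟩
    · rintro ⟨h1, h2, h3⟩; exact ⟨h2, by omega⟩
  rw [hS]
  exact (isOpen_le_fieldRank i).isLocallyClosed.inter
    ((isClosed_fiber h).inter (isOpen_le_fieldRank (i + 1)).isClosed_compl).isLocallyClosed

theorem momentMap_monic (A : PhaseSpace g) :
    (momentMap g A).Monic ∧ (momentMap g A).natDegree = 2 * g + 1 := by
  have huw : (uPoly g A * wPoly g A).Monic := (uPoly_monic g A).mul (wPoly_monic g A)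
  have hdeg : (uPoly g A * wPoly g A).natDegree = 2 * g + 1 := by
    rw [(uPoly_monic g A).natDegree_mul (wPoly_monic g A), natDegree_uPoly, natDegree_wPoly]; ring
  have hv : (vPoly g A ^ 2).degree < (uPoly g A * wPoly g A).degree := by
    rw [degree_eq_natDegree huw.ne_zero, hdeg, pow_two]
    exact degree_mul_lt_of_lt (degree_vPoly_lt g A) (degree_vPoly_lt g A) (by omega)
  rw [momentMap_eq]
  refine ⟨huw.add_of_right hv, ?_⟩
  rw [natDegree_add_eq_right_of_degree_lt hv, hdeg]

theorem degree_momentMap_sub_lt {h : ℂ[X]} (hmonic : h.Monic) (hdeg : h.natDegree = 2 * g + 1)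
    (A : PhaseSpace g) : (momentMap g A - h).degree < (2 * g + 1 : ℕ) := by
  obtain ⟨hm, hn⟩ := momentMap_monic A
  have := degree_sub_lt_left (p := momentMap g A) (q := h) (by
    rw [degree_eq_natDegree hm.ne_zero, degree_eq_natDegree hmonic.ne_zero, hn, hdeg])
    hm.ne_zero (by rw [hm.leadingCoeff, hmonic.leadingCoeff])
  rwa [degree_eq_natDegree hm.ne_zero, hn] at this

theorem degree_divByMonic_lt_of_lt {p q : ℂ[X]} (hq : q.Monic) {m k : ℕ} (hp : p.degree < m)
    (hk : m ≤ q.natDegree + k) (hk0 : 0 < k) : (p /ₘ q).degree < k := by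
  by_cases h0 : p /ₘ q = 0
  · rw [h0, degree_zero]; exact WithBot.bot_lt_coe _
  have hp0 : p ≠ 0 := fun h => h0 (by rw [h, zero_divByMonic])
  rw [degree_eq_natDegree hp0] at hp
  rw [degree_eq_natDegree h0, natDegree_divByMonic p hq]
  norm_cast at hp ⊢
  omega

theorem stratumEquation_eq_zero_iff {h Q : ℂ[X]} {i : ℕ} (hmonic : h.Monic)
    (hdeg : h.natDegree = 2 * g + 1) (hQ : Q.Monic) (hQh : Q ^ 2 ∣ h)
    (hi : Q.natDegree + i = g) (A : PhaseSpace g) :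
    (∀ j, MvPolynomial.eval A (stratumEquation h Q i j) = 0) ↔ DividesLax Q A ∧ A ∈ fiber g h := by
  have hQ2 : (Q ^ 2).Monic := hQ.pow 2
  have hmod : ∀ p : ℂ[X], (∀ j : Fin Q.natDegree, (p %ₘ Q).coeff j = 0) ↔ Q ∣ p := by
    intro p
    rw [← modByMonic_eq_zero_iff_dvd hQ]
    refine ⟨fun hp => ?_, fun hp j => by rw [hp, coeff_zero]⟩
    ext n
    by_cases hn : n < Q.natDegree
    · exact hp ⟨n, hn⟩
    · refine coeff_eq_zero_of_degree_lt ((degree_modByMonic_lt p hQ).trans_le ?_)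
      rw [degree_eq_natDegree hQ.ne_zero]
      exact_mod_cast not_lt.1 hn
  have hmap : (momentMap g MvPolynomial.X - h.map MvPolynomial.C).map (MvPolynomial.eval A) =
      momentMap g A - h := by
    rw [Polynomial.map_sub, map_eval_momentMap, map_C_map_eval]
  -- Both polynomials are monic of degree 2g + 1, so their difference has degree at most 2g and its
  -- quotient by Q² at most 2g - 2 deg Q = 2i: the 2i + 1 listed coefficients are all of them.
  have hdiv : Q ^ 2 ∣ momentMap g A - h →
      ((∀ j : Fin (2 * i + 1), ((momentMap g A - h) /ₘ Q ^ 2).coeff j = 0) ↔ A ∈ fiber g h) := by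
    intro hd
    have hlt : ((momentMap g A - h) /ₘ Q ^ 2).degree < (2 * i + 1 : ℕ) :=
      degree_divByMonic_lt_of_lt hQ2 (degree_momentMap_sub_lt hmonic hdeg A)
        (by rw [hQ.natDegree_pow]; omega) (by omega)
    constructor
    · intro hc
      have h0 : (momentMap g A - h) /ₘ Q ^ 2 = 0 := by
        ext n
        by_cases hn : n < 2 * i + 1
        · exact hc ⟨n, hn⟩
        · exact coeff_eq_zero_of_degree_lt (hlt.trans_le (by exact_mod_cast not_lt.1 hn))
      have h1 := modByMonic_add_div (momentMap g A - h) (Q ^ 2)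
      rw [h0, (modByMonic_eq_zero_iff_dvd hQ2).2 hd, mul_zero, add_zero] at h1
      exact sub_eq_zero.1 h1.symm
    · intro hA j
      have : momentMap g A = h := hA
      rw [this, sub_self, zero_divByMonic, coeff_zero]
  simp only [Sum.forall, stratumEquation, eval_coeff_modByMonic A _ hQ, map_eval_uPoly,
    map_eval_vPoly, map_eval_wPoly, eval_coeff_divByMonic A _ hQ2, hmap, hmod]
  constructor
  · rintro ⟨h1, h2, h3, h4⟩
    have h5 : DividesLax Q A := ⟨h1, h2, h3⟩
    exact ⟨h5, (hdiv (dvd_sub h5.sq_dvd hQh)).1 h4⟩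
  · rintro ⟨h5, h4⟩
    exact ⟨h5.1, h5.2.1, h5.2.2, (hdiv (dvd_sub h5.sq_dvd hQh)).2 h4⟩

theorem exists_tangent {a b c : ℂ[X]} (ha : a.degree < g) (hb : b.degree < g)
    (hc : c.degree < (g + 1 : ℕ)) :
    ∃ δ : PhaseSpace g, uTangent g δ = a ∧ vPoly g δ = b ∧ wTangent g δ = c := by
  rw [degree_lt_iff_coeff_zero] at ha hb hc
  refine ⟨Sum.elim (fun j => a.coeff j) (Sum.elim (fun j => b.coeff j) fun j => c.coeff j),
    ?_, ?_, ?_⟩ <;> ext n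
  · rw [coeff_uTangent]
    split_ifs with hn
    · rfl
    · exact (ha n (by omega)).symm
  · rw [coeff_vPoly]
    split_ifs with hn
    · rfl
    · exact (hb n (by omega)).symm
  · rw [coeff_wTangent]
    split_ifs with hn
    · rfl
    · exact (hc n (by omega)).symm

theorem add_mul_modByMonic_eq {ρ Q α : ℂ[X]} (hQ : Q.Monic) (hρ : ρ.degree < Q.natDegree) :
    (ρ + Q * α) %ₘ Q = ρ :=
  (div_modByMonic_unique α ρ hQ ⟨rfl, by rwa [degree_eq_natDegree hQ.ne_zero]⟩).2

theorem degree_sum_C_mul_X_pow_lt {m : ℕ} (c : Fin m → ℂ) :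
    (∑ i : Fin m, C (c i) * X ^ (i : ℕ)).degree < (m : WithBot ℕ) := by
  rw [degree_lt_iff_coeff_zero]
  intro n hn
  rw [coeff_sum_C_mul_X_pow, dif_neg (by omega)]

/-- Along (ρu + Qα, ρv + Qβ, ρw + Qγ) the remainders modulo Q vary by the prescribed ρ's, and the
moment map by N + Q² (2v'β + u'γ + w'α), where N depends only on the ρ's. It remains to give the
bracket the value τ minus the quotient of N by Q². -/
theorem GcdFactorization.exists_jacobian_eq {A : PhaseSpace g} {Q : ℂ[X]}
    (F : GcdFactorization A Q) (h : ℂ[X])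
    (t : Fin Q.natDegree ⊕ Fin Q.natDegree ⊕ Fin Q.natDegree ⊕ Fin (2 * F.u.natDegree + 1) → ℂ) :
    ∃ δ : Coord g → ℂ, ∀ j, ∑ a, δ a * MvPolynomial.eval A
      (MvPolynomial.pderiv a (stratumEquation h Q F.u.natDegree j)) = t j := by
  have hQ := F.monic
  have hQ2 : (Q ^ 2).Monic := hQ.pow 2
  have hadd := F.natDegree_add
  set ρu : ℂ[X] := ∑ j : Fin Q.natDegree, C (t (.inl j)) * X ^ (j : ℕ)
  set ρv : ℂ[X] := ∑ j : Fin Q.natDegree, C (t (.inr (.inl j))) * X ^ (j : ℕ)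
  set ρw : ℂ[X] := ∑ j : Fin Q.natDegree, C (t (.inr (.inr (.inl j)))) * X ^ (j : ℕ)
  set τ : ℂ[X] := ∑ j : Fin (2 * F.u.natDegree + 1), C (t (.inr (.inr (.inr j)))) * X ^ (j : ℕ)
  have hρu : ρu.degree < Q.natDegree := degree_sum_C_mul_X_pow_lt _
  have hρv : ρv.degree < Q.natDegree := degree_sum_C_mul_X_pow_lt _
  have hρw : ρw.degree < Q.natDegree := degree_sum_C_mul_X_pow_lt _
  have hτ : τ.degree < (2 * F.u.natDegree + 1 : ℕ) := degree_sum_C_mul_X_pow_lt _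
  set N : ℂ[X] := C 2 * (vPoly g A * ρv) + uPoly g A * ρw + wPoly g A * ρu
  have hN : N.degree < (g + Q.natDegree + 1 : ℕ) := by
    refine degree_add_lt_of_lt (degree_add_lt_of_lt ?_ ?_) ?_
    · rw [degree_C_mul two_ne_zero]
      exact degree_mul_lt_of_lt (degree_vPoly_lt g A) hρv (by omega)
    · exact degree_mul_lt_of_lt (degree_lt_succ_natDegree _) hρw (by rw [natDegree_uPoly]; omega)
    · exact degree_mul_lt_of_lt (degree_lt_succ_natDegree _) hρu (by rw [natDegree_wPoly]; omega)
  have hP : (τ - N /ₘ Q ^ 2).degree < (2 * F.u.natDegree + 1 : ℕ) :=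
    (degree_sub_le _ _).trans_lt (max_lt hτ (degree_divByMonic_lt_of_lt hQ2 hN
      (by rw [hQ.natDegree_pow]; omega) (by omega)))
  obtain ⟨α, β, γ, hα, hβ, hγ, heq⟩ :=
    exists_mul_add_mul_add_mul_eq F.u_monic F.degree_v_lt F.natDegree_w F.bezout hP
  have hle : ∀ {ρ : ℂ[X]} {m : ℕ}, ρ.degree < Q.natDegree → Q.natDegree ≤ m → ρ.degree < m :=
    fun hρ hm => hρ.trans_le (by exact_mod_cast hm)
  obtain ⟨δ, hδu, hδv, hδw⟩ := exists_tangent (g := g) (a := ρu + Q * α) (b := ρv + Q * β)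
    (c := ρw + Q * γ)
    (degree_add_lt_of_lt (hle hρu (by omega))
      (degree_mul_lt_of_lt (degree_lt_succ_natDegree _) hα (by omega)))
    (degree_add_lt_of_lt (hle hρv (by omega))
      (degree_mul_lt_of_lt (degree_lt_succ_natDegree _) hβ (by omega)))
    (degree_add_lt_of_lt (hle hρw (by omega))
      (degree_mul_lt_of_lt (degree_lt_succ_natDegree _) hγ (by omega)))
  have hderiv : momentMapDeriv g A δ /ₘ Q ^ 2 = τ := by
    refine (div_modByMonic_unique τ (N %ₘ Q ^ 2) hQ2 ⟨?_, degree_modByMonic_lt _ hQ2⟩).1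
    have h1 := modByMonic_add_div N (Q ^ 2)
    have h2 : N = 2 * (vPoly g A * ρv) + uPoly g A * ρw + wPoly g A * ρu := rfl
    rw [momentMapDeriv, hδu, hδv, hδw]
    rw [F.uPoly_eq, F.vPoly_eq, F.wPoly_eq] at h2 ⊢
    linear_combination h1 - Q ^ 2 * heq + h2
  have hH : (momentMap g MvPolynomial.X - h.map MvPolynomial.C).map
      (dualEval A δ : Functions g →+* DualNumber ℂ) =
        dualPoly (momentMap g A - h) (momentMapDeriv g A δ) := by
    rw [Polynomial.map_sub, momentMap_map_dualEval, map_dualEval_map_C]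
    simp only [dualPoly, Polynomial.map_sub]
    ring
  refine ⟨δ, ?_⟩
  rintro (j | j | j | j) <;> dsimp only [stratumEquation]
  · rw [sum_mul_eval_pderiv_coeff g A δ (map_dualEval_modByMonic hQ (uPoly_map_dualEval g A δ)), hδu,
      add_mul_modByMonic_eq hQ hρu, coeff_sum_C_mul_X_pow fun j => t (.inl j), dif_pos j.2]
  · rw [sum_mul_eval_pderiv_coeff g A δ (map_dualEval_modByMonic hQ (vPoly_map_dualEval g A δ)), hδv,
      add_mul_modByMonic_eq hQ hρv, coeff_sum_C_mul_X_pow fun j => t (.inr (.inl j)), dif_pos j.2]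
  · rw [sum_mul_eval_pderiv_coeff g A δ (map_dualEval_modByMonic hQ (wPoly_map_dualEval g A δ)), hδw,
      add_mul_modByMonic_eq hQ hρw, coeff_sum_C_mul_X_pow fun j => t (.inr (.inr (.inl j))),
      dif_pos j.2]
  · rw [sum_mul_eval_pderiv_coeff g A δ (map_dualEval_divByMonic hQ2 hH), hderiv,
      coeff_sum_C_mul_X_pow fun j => t (.inr (.inr (.inr j))), dif_pos j.2]

/-- Near a point of the fibre over `h`, the stratum of the point is cut out by the equations
`stratumEquation`. -/
theorem GcdFactorization.exists_isOpen {h : ℂ[X]} (hmonic : h.Monic)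
    (hdeg : h.natDegree = 2 * g + 1) {A : PhaseSpace g} {Q : ℂ[X]} (F : GcdFactorization A Q)
    (hA : A ∈ fiber g h) :
    ∃ U : Set (PhaseSpace g), IsOpen[zariskiTopology _] U ∧ A ∈ U ∧
      ∀ B ∈ U, B ∈ fiberStratum g F.u.natDegree h ↔
        ∀ j, MvPolynomial.eval B (stratumEquation h Q F.u.natDegree j) = 0 := by
  let _ := zariskiTopology (Coord g)
  have hfib : ∀ B : PhaseSpace g, B ∈ fiber g h ↔ momentMap g B = h := fun B => Iff.rfl
  have hQh : Q ^ 2 ∣ h := (hfib A).1 hA ▸ F.dividesLax.sq_dvd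
  -- The other candidates for a greatest common divisor of the same degree; there are finitely many
  -- because each divides h. The neighbourhood excludes them and forbids the rank from dropping.
  let T : Set ℂ[X] := {P | (P.Monic ∧ P ∣ h) ∧ P ≠ Q ∧ P.natDegree = Q.natDegree}
  have hT : T.Finite := by
    have : Finite ↑{P : ℂ[X] | P.Monic ∧ P ∣ h} :=
      @Finite.of_fintype _ (fintypeSubtypeMonicDvd h hmonic.ne_zero)
    exact (Set.toFinite {P : ℂ[X] | P.Monic ∧ P ∣ h}).subset fun P hP => hP.1
  refine ⟨{B | F.u.natDegree ≤ fieldRank B} ∩ ⋂ P ∈ T, {B | DividesLax P B}ᶜ, ?_, ?_, ?_⟩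
  · exact (isOpen_le_fieldRank _).inter (hT.isOpen_biInter fun P hP =>
      (isClosed_dividesLax hP.1.1).isOpen_compl)
  · refine ⟨F.fieldRank_eq.ge, Set.mem_iInter₂.2 fun P hP hPA => hP.2.1 ?_⟩
    exact eq_of_monic_of_dvd_of_natDegree_le hP.1.1 F.monic (F.dvd_of_dvd hPA.1 hPA.2.1 hPA.2.2)
      hP.2.2.ge |>.symm
  · rintro B ⟨hBrank, hBT⟩
    rw [Set.mem_iInter₂] at hBT
    rw [stratumEquation_eq_zero_iff hmonic hdeg F.monic hQh F.natDegree_add]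
    obtain ⟨P, ⟨FB⟩⟩ := exists_gcdFactorization B
    have haddA := F.natDegree_add
    have haddB := FB.natDegree_add
    change (B ∈ fiber g h ∧ fieldRank B = F.u.natDegree) ↔ _
    rw [FB.fieldRank_eq]
    change F.u.natDegree ≤ fieldRank B at hBrank
    rw [FB.fieldRank_eq] at hBrank
    constructor
    -- Equal rank means that the divisor P of B has the degree of Q, so P = Q as the alternatives
    -- are excluded. Conversely, if Q divides the entries at B, then Q divides P and the rank cannot
    -- exceed that at A, while the neighbourhood bounds it from below.
    · rintro ⟨hB, hrank⟩
      refine ⟨?_, hB⟩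
      by_cases hPQ : P = Q
      · exact hPQ ▸ FB.dividesLax
      · have hPh : P ^ 2 ∣ h := (hfib B).1 hB ▸ FB.dividesLax.sq_dvd
        exact absurd FB.dividesLax
          (hBT P ⟨⟨FB.monic, (dvd_pow_self P two_ne_zero).trans hPh⟩, hPQ, by omega⟩)
    · rintro ⟨hQB, hB⟩
      have hle := natDegree_le_of_dvd (FB.dvd_of_dvd hQB.1 hQB.2.1 hQB.2.2) FB.monic.ne_zero
      exact ⟨hB, by omega⟩

theorem isRegularLocalRing_fiberStratum {h : ℂ[X]} (hmonic : h.Monic)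
    (hdeg : h.natDegree = 2 * g + 1) {i : ℕ} {A : PhaseSpace g} (hA : A ∈ fiberStratum g i h) :
    IsRegularLocalRing (LocalRing (fiberStratum g i h) A) ∧
      ringKrullDim (LocalRing (fiberStratum g i h) A) = i := by
  obtain ⟨Q, ⟨F⟩⟩ := exists_gcdFactorization A
  have hi : F.u.natDegree = i := F.fieldRank_eq.symm.trans hA.2
  obtain ⟨U, hU, hAU, hS⟩ := F.exists_isOpen hmonic hdeg hA.1
  have hadd := F.natDegree_add
  rw [← hi] at hA ⊢
  obtain ⟨hreg, hdim⟩ := isRegularLocalRing_localRing hA hU hAU _ hS (F.exists_jacobian_eq h)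
  refine ⟨hreg, ?_⟩
  -- Regularity replaces the Krull dimension d by a natural number, so that d + 3 deg Q + 2i + 1 =
  -- 3g + 1 and deg Q + i = g give d = i.
  rw [← hreg.spanFinrank_maximalIdeal] at hdim ⊢
  simp only [Fintype.card_sum, Fintype.card_fin] at hdim
  norm_cast at hdim ⊢
  omega

end Mumford

end

theorem proposition3p19 (g : ℕ) (h : Polynomial ℂ) (hmonic : h.Monic)
    (hdeg : h.natDegree = 2 * g + 1) (i : ℕ)
    (hne : (Mumford.fiberStratum g i h).Nonempty) :
    ClassicalVariety.IsQuasiAffine (Mumford.fiberStratum g i h) ∧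
      ClassicalVariety.IsSmooth (Mumford.fiberStratum g i h) ∧
      ClassicalVariety.IsEquidimensional (Mumford.fiberStratum g i h) i ∧
      ClassicalVariety.dimension (Mumford.fiberStratum g i h) = i := by
  have hq := Mumford.isQuasiAffine_fiberStratum (g := g) i h
  have he : ClassicalVariety.IsEquidimensional (Mumford.fiberStratum g i h) i := fun _ hA =>
    (Mumford.isRegularLocalRing_fiberStratum hmonic hdeg hA).2
  exact ⟨hq, fun _ hA => (Mumford.isRegularLocalRing_fiberStratum hmonic hdeg hA).1, he,
    ClassicalVariety.dimension_eq_of_isEquidimensional hq hne he⟩
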